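/- **Setting.** Let $1\le W\le N$ be integers and let $\mathbb Z_N=\mathbb Z\cap(-N/2,N/2]$, with indices taken modulo $N$. Fix constants $c_s,C_s>0$ and $(\mu_p)_{p\in\mathbb N}$, $\mu_p>0$. Let $f:\mathbb Z_N\to[0,\infty)$ be symmetric with $\sum_x f(x)=1$ and $$c_sW^{-1}\mathbf 1_{|x|\le W}\le f(x)\le C_sW^{-1}\mathbf 1_{|x|\le C_sW},\qquad x\in\mathbb Z_N .$$ For $\zeta\ge 0$ let $S=S_\zeta$ be the matrix with entries $S_{ij}=f(i-j)-\zeta\,\frac{1+\delta_{ij}}{W}\mathbf 1_{i,j\in\{1,\dots,W\}}$. Let $H$ be a random $N\times N$ real symmetric matrix whose entries are centered and independent up to the symmetry, with $\mathbb E|H_{ij}|^2=S_{ij}$ and $(\mathbb E|H_{ij}|^p)^{1/p}\le\mu_p\,\mathrm{Var}(H_{ij})^{1/2}$ for all integers $p\ge1$. For $\mathbf g\in\mathbb R^N$ and $z,\widetilde z\in\mathbb C$ with nonnegative imaginary parts put $z_i=z$ for $i\in\{1,\dots,W\}$, $z_i=\widetilde z$ otherwise, and $$G=G(z,\widetilde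 z)=\big(H-\mathrm{diag}(g_i)-\mathrm{diag}(z_i)\big)^{-1},\qquad T_{ij}=\sum_kS_{ik}|G_{kj}|^2 .$$ Let $m_{\rm sc}(z)=\frac{-z+\sqrt{z^2-4}}2$ be the Stieltjes transform of the semicircle law on the upper half plane, and let $m_{\rm sc}(\widetilde z+\mathrm i0^+)$ denote its boundary value when $\widetilde z$ is real. For $c_1>0$ consider the system $$M_i^{-1}=-z_i-g_i-\sum_jS_{ij}M_j,\qquad \max_i|M_i-m_{\rm sc}(\widetilde z+\mathrm i0^+)|\le c_1,\qquad i\in\mathbb Z_N. \tag{1}$$ Write $\|X\|_{\max}=\max_{i,j}|X_{ij}|$. **Lemma 2.1 (Self-consistent equation estimate).** Let $\kappa>0$. There are constants $c_0,c_1>0$, depending only on $\kappa,c_s,C_s$, such that the following holds for all data as above with $|\mathrm{Re}\,\widetilde z|\le2-\kappa$ and $$\zeta+\|\mathbf g\|_\infty+|z-\widetilde z|\le c_0 .$$ (i) The system (1) has exactly one solution $(M_i)_{i\in\mathbb Z_N}$. Write $M=M(z,\widetilde z)=\mathrm{diag}(M_i)$. (ii) For all $\delta,\tau,D>0$ there is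 $N_0$, depending only on $\kappa,c_s,C_s,(\mu_p)_p,\delta,\tau,D$, such that for $N\ge N_0$: if $\Phi\ge W^{-1/2}$ is deterministic and $\Omega$ is a subset of the sample space on which $G(z,\widetilde z)$ exists and $$\|G(z,\widetilde z)-M(z,\widetilde z)\|_{\max}\le N^{-\delta},\qquad \|T\|_{\max}\le\Phi^2,$$ then $$\mathbb P\Big(\mathbf 1_\Omega\,\|G(z,\widetilde z)-M(z,\widetilde z)\|_{\max}\ge N^\tau\Phi\Big)\le N^{-D}.$$ -/

import Mathlib

open MeasureTheory ProbabilityTheory Filter Topology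
open scoped Matrix

noncomputable section

namespace BandMatrix

/-- The max norm `‖X‖_max = max_{i,j} |X i j|` of a matrix. -/
def maxNorm {n α : Type*} [Norm α] (X : Matrix n n α) : ℝ :=
  ⨆ i, ⨆ j, ‖X i j‖

/-- The Stieltjes transform `(-z + √(z² - 4)) / 2` of the semicircle law. The square root is written
as the product of the principal roots of `z - 2` and `z + 2`; on the open upper half plane this is
the branch that behaves like `z` at infinity, and since the principal root is continuous from above
along the negative axis, the value at a real `z` is the boundary value at `z + i 0⁺`
(see `msc_tendsto`). -/
def msc (z : ℂ) : ℂ :=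
  (-z + (z - 2) ^ (1 / 2 : ℂ) * (z + 2) ^ (1 / 2 : ℂ)) / 2

theorem cpow_half_tendsto (a : ℂ) (ha : 0 ≤ a.im) :
    Tendsto (fun η : ℝ => (a + η * Complex.I) ^ (1 / 2 : ℂ)) (𝓝[>] 0)
      (𝓝 (a ^ (1 / 2 : ℂ))) := by
  have hlin : Tendsto (fun η : ℝ => a + η * Complex.I) (𝓝[>] 0) (𝓝 a) := by
    have h : Continuous (fun η : ℝ => a + η * Complex.I) := by fun_prop
    have h0 := h.tendsto 0
    simp only [Complex.ofReal_zero, zero_mul, add_zero] at h0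
    exact h0.mono_left nhdsWithin_le_nhds
  by_cases h0 : a = 0
  · subst h0
    have hc : ContinuousAt (fun x : ℂ => x ^ (1 / 2 : ℂ)) 0 := by
      have := Complex.continuousAt_cpow_zero_of_re_pos (z := (1 / 2 : ℂ)) (by norm_num)
      exact ContinuousAt.comp (f := fun x : ℂ => (x, (1 / 2 : ℂ))) this (by fun_prop)
    exact hc.tendsto.comp hlin
  · have hmem : Tendsto (fun η : ℝ => a + η * Complex.I) (𝓝[>] 0)
        (𝓝[{z : ℂ | 0 ≤ z.im}] a) := by
      refine tendsto_nhdsWithin_iff.2 ⟨hlin, ?_⟩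
      filter_upwards [self_mem_nhdsWithin] with η hη
      have : (0 : ℝ) < η := hη
      simp
      linarith
    have hlog : Tendsto (fun η : ℝ => Complex.log (a + η * Complex.I)) (𝓝[>] 0)
        (𝓝 (Complex.log a)) := by
      by_cases hs : a ∈ Complex.slitPlane
      · exact (continuousAt_clog hs).tendsto.comp hlin
      · have him : a.im = 0 := by
          by_contra h
          exact hs (Or.inr h)
        have hre : a.re < 0 := by
          rcases lt_trichotomy a.re 0 with h | h | h
          · exact h
          · exact absurd (Complex.ext h him) h0
          · exact absurd (Or.inl h) hs
        have := Complex.continuousWithinAt_log_of_re_neg_of_im_zero hre him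
        exact this.tendsto.comp hmem
    have hexp : Tendsto (fun η : ℝ => Complex.exp (Complex.log (a + η * Complex.I) * (1 / 2)))
        (𝓝[>] 0) (𝓝 (Complex.exp (Complex.log a * (1 / 2)))) :=
      (Complex.continuous_exp.tendsto _).comp (hlog.mul_const _)
    rw [Complex.cpow_def_of_ne_zero h0]
    refine hexp.congr' ?_
    filter_upwards [self_mem_nhdsWithin] with η hη
    have hη' : (0 : ℝ) < η := hη
    rw [Complex.cpow_def_of_ne_zero]
    intro h
    have := congrArg Complex.im h
    simp at this
    linarith

/-- On the closed upper half plane `msc z` is the boundary value `m_sc(z + i 0⁺)`. -/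
theorem msc_tendsto (z : ℂ) (hz : 0 ≤ z.im) :
    Tendsto (fun η : ℝ => msc (z + η * Complex.I)) (𝓝[>] 0) (𝓝 (msc z)) := by
  have h1 := cpow_half_tendsto (z - 2) (by simpa using hz)
  have h2 := cpow_half_tendsto (z + 2) (by simpa using hz)
  have h3 : Tendsto (fun η : ℝ => z + η * Complex.I) (𝓝[>] 0) (𝓝 z) := by
    have h : Continuous (fun η : ℝ => z + η * Complex.I) := by fun_prop
    have h0 := h.tendsto 0
    simp only [Complex.ofReal_zero, zero_mul, add_zero] at h0
    exact h0.mono_left nhdsWithin_le_nhds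
  have h4 := (h3.neg.add (h1.mul h2)).div_const 2
  refine h4.congr fun η => ?_
  unfold msc
  congr 4 <;> ring

/-- `msc z` solves the self-consistent equation `m⁻¹ = -z - m` of the semicircle law. -/
theorem msc_quadratic (z : ℂ) : msc z * (-z - msc z) = 1 := by
  have h : ∀ x : ℂ, (x ^ (1 / 2 : ℂ)) ^ 2 = x := fun x => by
    rw [← Complex.cpow_nat_mul]; norm_num
  have h1 := h (z - 2)
  have h2 := h (z + 2)
  have h3 : ((z - 2) ^ (1 / 2 : ℂ) * (z + 2) ^ (1 / 2 : ℂ)) ^ 2 = (z - 2) * (z + 2) := by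
    rw [mul_pow, h1, h2]
  unfold msc
  linear_combination (-1 / 4 : ℂ) * h3

/-- `f` is a variance profile of bandwidth `W` on `ℤ_N` with constants `cs`, `Cs`. Indices are
residues modulo `N`, and `|x|` is the absolute value of the representative of `x` in
`(-N/2, N/2]`. -/
structure IsBandProfile (N : ℕ) [NeZero N] (W : ℕ) (cs Cs : ℝ) (f : ZMod N → ℝ) : Prop where
  nonneg : ∀ x, 0 ≤ f x
  symm : ∀ x, f (-x) = f x
  sum_eq_one : ∑ x, f x = 1
  lower : ∀ x : ZMod N, (x.valMinAbs.natAbs : ℝ) ≤ W → cs * (W : ℝ)⁻¹ ≤ f x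
  upper : ∀ x : ZMod N, (x.valMinAbs.natAbs : ℝ) ≤ Cs * W → f x ≤ Cs * (W : ℝ)⁻¹
  support : ∀ x : ZMod N, Cs * W < (x.valMinAbs.natAbs : ℝ) → f x = 0

/-- The block `⟦1, W⟧` of indices, as residues modulo `N`. -/
def block (N W : ℕ) : Set (ZMod N) :=
  {i | ∃ k : ℕ, 1 ≤ k ∧ k ≤ W ∧ (k : ZMod N) = i}

open Classical in
/-- The matrix `Σ_{ij} = (1 + δ_{ij}) W⁻¹ 1(i, j ∈ ⟦1, W⟧)`. -/
def blockSigma (N W : ℕ) : Matrix (ZMod N) (ZMod N) ℝ :=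
  Matrix.of fun i j =>
    if i ∈ block N W ∧ j ∈ block N W then (1 + if i = j then 1 else 0) / (W : ℝ) else 0

/-- The variance matrix `S_ζ = S₀ - ζ Σ`, where `(S₀)_{ij} = f (i - j)`. -/
def varMatrix (N W : ℕ) (f : ZMod N → ℝ) (ζ : ℝ) : Matrix (ZMod N) (ZMod N) ℝ :=
  (Matrix.of fun i j => f (i - j)) - ζ • blockSigma N W

/-- The random real symmetric matrix `H = H_ζ`: its entries are centered, independent up to the
symmetry, have variances `S i j`, and satisfy `(E |H_{ij}|^p)^{1/p} ≤ μ_p Var(H_{ij})^{1/2}`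
for every integer `p ≥ 1`. -/
structure IsBandEnsemble {N : ℕ} {Ω : Type*} [MeasurableSpace Ω] (P : Measure Ω)
    (S : Matrix (ZMod N) (ZMod N) ℝ) (μ : ℕ → ℝ)
    (H : Ω → Matrix (ZMod N) (ZMod N) ℝ) : Prop where
  measurable : ∀ i j, Measurable fun ω => H ω i j
  symm : ∀ ω i j, H ω i j = H ω j i
  indep : iIndepFun
    (fun (p : {p : ZMod N × ZMod N // p.1.val ≤ p.2.val}) ω => H ω p.1.1 p.1.2) P
  moments_integrable : ∀ i j (p : ℕ), Integrable (fun ω => |H ω i j| ^ p) P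
  mean_zero : ∀ i j, ∫ ω, H ω i j ∂P = 0
  second_moment : ∀ i j, ∫ ω, |H ω i j| ^ 2 ∂P = S i j
  moments : ∀ i j (p : ℕ), 1 ≤ p →
    (∫ ω, |H ω i j| ^ p ∂P) ^ (1 / (p : ℝ)) ≤ μ p * √(variance (fun ω => H ω i j) P)

open Classical in
/-- The spectral parameter at index `i`: `z` on `⟦1, W⟧` and `w` off it. -/
def spectralParam (N W : ℕ) (z w : ℂ) (i : ZMod N) : ℂ :=
  if i ∈ block N W then z else w

/-- `H^g - diag(z, …, z, w, …, w)`, where `H^g = H - diag(g)`. -/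
def shifted {N : ℕ} (W : ℕ) (H : Matrix (ZMod N) (ZMod N) ℝ) (g : ZMod N → ℝ) (z w : ℂ) :
    Matrix (ZMod N) (ZMod N) ℂ :=
  (H - Matrix.diagonal g).map (fun x : ℝ => (x : ℂ)) - Matrix.diagonal (spectralParam N W z w)

/-- The generalized resolvent `G(z, w)`. -/
def resolvent {N : ℕ} [NeZero N] (W : ℕ) (H : Matrix (ZMod N) (ZMod N) ℝ) (g : ZMod N → ℝ)
    (z w : ℂ) : Matrix (ZMod N) (ZMod N) ℂ :=
  (shifted W H g z w)⁻¹

/-- The matrix `T_{ij} = ∑_k S_{ik} |G_{kj}|²`. -/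
def tMatrix {N : ℕ} [NeZero N] (S : Matrix (ZMod N) (ZMod N) ℝ)
    (G : Matrix (ZMod N) (ZMod N) ℂ) : Matrix (ZMod N) (ZMod N) ℝ :=
  Matrix.of fun i j => ∑ k, S i k * ‖G k j‖ ^ 2

/-- `M` is a solution vector of the self-consistent equations
`M_i⁻¹ = -z 1(i ∈ ⟦1, W⟧) - w 1(i ∉ ⟦1, W⟧) - g_i - ∑_j S_{ij} M_j` whose entries all lie within
distance `c` of `m_sc(w + i 0⁺)`. -/
structure IsSelfConsistent {N : ℕ} [NeZero N] (W : ℕ) (S : Matrix (ZMod N) (ZMod N) ℝ)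
    (g : ZMod N → ℝ) (z w : ℂ) (c : ℝ) (M : ZMod N → ℂ) : Prop where
  ne_zero : ∀ i, M i ≠ 0
  eqn : ∀ i, (M i)⁻¹ = -spectralParam N W z w i - (g i : ℂ) - ∑ j, (S i j : ℂ) * M j
  near : ∀ i, ‖M i - msc w‖ ≤ c

/-- The standing assumptions on the deterministic data, with `w` in the role of the second spectral
parameter. The norm of `g` is the sup norm. -/
structure IsAdmissible (κ cs Cs c₀ : ℝ) (N : ℕ) [NeZero N] (W : ℕ) (f : ZMod N → ℝ) (ζ : ℝ)
    (g : ZMod N → ℝ) (z w : ℂ) : Prop where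
  one_le : 1 ≤ W
  le_size : W ≤ N
  profile : IsBandProfile N W cs Cs f
  zeta_nonneg : 0 ≤ ζ
  im_z_nonneg : 0 ≤ z.im
  im_w_nonneg : 0 ≤ w.im
  re_w_le : |w.re| ≤ 2 - κ
  small : ζ + ‖g‖ + ‖z - w‖ ≤ c₀

end BandMatrix

end

/-! The matrix `M` is the stable fixed point of a perturbed semicircle equation, and Schur's
complement formula shows that the diagonal of `G` solves the same equation up to fluctuations of
size `Φ`.

Stability. Write `M = m + x` with `m = msc w`. The rows of the unperturbed variance matrix `T` sum
to one and `m⁻¹ = -w - m`, so the system becomes `x - m² T x = m x (T x) - m (m + x) (d + L x)`,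
where `d` and `L` are of the size of the perturbation (`scNonlin_identity`). In the bulk `m²` is
bounded away from `1`, although `|m|` may equal `1`. Iterating `x = y + q T x` twice gives `qT +
q²T²`, and since `T` and `T²` share a common part of positive mass, the phases in `1 + q` produce a
gain: `1 - m² T` has a sup-norm inverse bounded uniformly in `N` and `W` (`norm_le_of_dominates`).
Contraction then gives existence and uniqueness, and an approximate solution with residual `b` lies
within `2 K b` of `M`, where `K` is the stability constant.

Fluctuations. With `G^(i)` the inverse of the minor without row and column `i`, the entries `G_ij`
with `j ≠ i` are linear forms, and the residual of the equation for `G_ii` is built from quadratic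
forms, in row `i` of `H` with coefficients from `G^(i)`, which is independent of that row. Moment
bounds follow by adding one entry at a time: a centered independent increment raises the squared
`L^(2p)` norm additively up to a constant (`moment_step`). The event `E` need not be independent of
row `i`, so the large deviation bounds are self-normalized: each form is compared with its own
conditional variance, on an event of high probability that does not refer to `E`. Only afterwards
are the variances bounded deterministically on `E` through `T ≤ Φ²`
(`IsAdmissible.maxNorm_sub_le_of_isGoodRow`). -/

namespace BandMatrix

/-! ### The semicircle Stieltjes transform in the bulk. -/

theorem norm_msc_le_one {w : ℂ} (hw : 0 ≤ w.im) : ‖msc w‖ ≤ 1 := by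
  -- Halving the argument sends the closed upper half plane to the closed first quadrant.
  have hroot : ∀ x : ℂ, 0 ≤ x.im →
      0 ≤ (x ^ (1 / 2 : ℂ)).re ∧ 0 ≤ (x ^ (1 / 2 : ℂ)).im := by
    intro x hx
    have hre : ∀ a b : ℝ, ((a : ℂ) + b * Complex.I).re = a := by simp
    have him : ∀ a b : ℝ, ((a : ℂ) + b * Complex.I).im = b := by simp
    have harg := Complex.arg_nonneg_iff.2 hx
    have hpi := Complex.arg_le_pi x
    have he : (1 / 2 : ℂ) = ((1 / 2 : ℝ) : ℂ) := by push_cast; rfl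
    rw [he, Complex.cpow_ofReal]
    constructor
    · rw [Complex.re_ofReal_mul]
      have := Real.cos_nonneg_of_neg_pi_div_two_le_of_le (x := x.arg * (1 / 2))
        (by linarith [Real.pi_pos]) (by linarith)
      have h2 : 0 ≤ ‖x‖ ^ (1 / 2 : ℝ) := by positivity
      have h3 : ((Real.cos (x.arg * (1 / 2)) : ℂ) + (Real.sin (x.arg * (1 / 2)) : ℂ)
          * Complex.I).re = Real.cos (x.arg * (1 / 2)) := hre _ _
      rw [h3]
      positivity
    · rw [Complex.im_ofReal_mul]
      have := Real.sin_nonneg_of_nonneg_of_le_pi (x := x.arg * (1 / 2))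
        (by linarith [Real.pi_pos]) (by linarith)
      have h2 : 0 ≤ ‖x‖ ^ (1 / 2 : ℝ) := by positivity
      have h3 : ((Real.cos (x.arg * (1 / 2)) : ℂ) + (Real.sin (x.arg * (1 / 2)) : ℂ)
          * Complex.I).im = Real.sin (x.arg * (1 / 2)) := him _ _
      rw [h3]
      positivity
  have hsq : ∀ x : ℂ, (x ^ (1 / 2 : ℂ)) ^ 2 = x := fun x => by
    rw [← Complex.cpow_nat_mul]; norm_num
  obtain ⟨hu1, hu2⟩ := hroot (w - 2) (by simpa using hw)
  obtain ⟨hv1, hv2⟩ := hroot (w + 2) (by simpa using hw)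
  have hu := hsq (w - 2)
  have hv := hsq (w + 2)
  have hq := msc_quadratic w
  have hm : msc w = (-w + (w - 2) ^ (1 / 2 : ℂ) * (w + 2) ^ (1 / 2 : ℂ)) / 2 := rfl
  have hm' : -w - msc w = (-w - (w - 2) ^ (1 / 2 : ℂ) * (w + 2) ^ (1 / 2 : ℂ)) / 2 := by
    rw [hm]; ring
  set u := (w - 2) ^ (1 / 2 : ℂ)
  set v := (w + 2) ^ (1 / 2 : ℂ)
  -- The two roots of the quadratic equation are `-(u - v)² / 4` and `-(u + v)² / 4`. As `u` and `v`
  -- lie in the first quadrant, `Re (u v̄) ≥ 0`, so `msc w` is the smaller root; the product of the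
  -- roots has modulus `1`.
  have hle : Complex.normSq (msc w) ≤ Complex.normSq (-w - msc w) := by
    have hw2 : w = (u ^ 2 + v ^ 2) / 2 := by rw [hu, hv]; ring
    have key : Complex.normSq (-w - msc w) - Complex.normSq (msc w)
        = (Complex.normSq u + Complex.normSq v) * (u.re * v.re + u.im * v.im) / 2 := by
      rw [hm', hm, hw2]
      simp [Complex.normSq_apply, Complex.div_ofNat_re, Complex.div_ofNat_im, pow_two]
      ring
    have : 0 ≤ (Complex.normSq u + Complex.normSq v) * (u.re * v.re + u.im * v.im) / 2 := by
      have := Complex.normSq_nonneg u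
      have := Complex.normSq_nonneg v
      positivity
    linarith
  have h1 : Complex.normSq (msc w) * Complex.normSq (-w - msc w) = 1 := by
    rw [← Complex.normSq_mul, hq, Complex.normSq_one]
  have h2 : Complex.normSq (msc w) ≤ 1 := by
    have := Complex.normSq_nonneg (msc w)
    nlinarith
  rw [Complex.normSq_eq_norm_sq] at h2
  nlinarith [norm_nonneg (msc w)]

theorem msc_ne_zero (w : ℂ) : msc w ≠ 0 := fun h => by
  have := msc_quadratic w
  rw [h] at this
  simp at this

theorem inv_msc (w : ℂ) : (msc w)⁻¹ = -w - msc w :=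
  inv_eq_of_mul_eq_one_right (msc_quadratic w)

/-- In the bulk of the spectrum, `msc w ^ 2` stays away from `1`. -/
theorem norm_one_add_msc_sq_le {κ : ℝ} (hκ : 0 < κ) {w : ℂ} (hw : 0 ≤ w.im)
    (hre : |w.re| ≤ 2 - κ) : ‖1 + msc w ^ 2‖ ≤ 2 - κ / 8 := by
  have hκ2 : κ ≤ 2 := by linarith [abs_nonneg w.re]
  by_contra! hlt
  have h1 := norm_msc_le_one hw
  have hq := msc_quadratic w
  have hm0 := msc_ne_zero w
  generalize msc w = m at *
  have hns : m.re ^ 2 + m.im ^ 2 ≤ 1 := by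
    have : Complex.normSq m ≤ 1 := by
      rw [Complex.normSq_eq_norm_sq]; nlinarith [norm_nonneg m]
    rw [Complex.normSq_apply] at this
    linarith
  have hpos : 0 < m.re ^ 2 + m.im ^ 2 := by
    have := Complex.normSq_pos.2 hm0
    rw [Complex.normSq_apply] at this
    linarith
  have hsq : (2 - κ / 8) ^ 2 < (1 + (m.re ^ 2 - m.im ^ 2)) ^ 2 + (2 * m.re * m.im) ^ 2 := by
    have h2 : (2 - κ / 8) ^ 2 < ‖1 + m ^ 2‖ ^ 2 := by
      apply pow_lt_pow_left₀ hlt (by linarith) (by norm_num)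
    rw [← Complex.normSq_eq_norm_sq, Complex.normSq_apply] at h2
    simp only [Complex.add_re, Complex.one_re, pow_two, Complex.mul_re, Complex.add_im,
      Complex.one_im, Complex.mul_im] at h2 ⊢
    convert h2 using 1
    ring
  have hre2 : 1 - κ / 4 ≤ m.re ^ 2 := by
    have e : (1 + (m.re ^ 2 - m.im ^ 2)) ^ 2 + (2 * m.re * m.im) ^ 2
        = 1 + 2 * (m.re ^ 2 - m.im ^ 2) + (m.re ^ 2 + m.im ^ 2) ^ 2 := by ring
    have e2 : (m.re ^ 2 + m.im ^ 2) ^ 2 ≤ 1 := pow_le_one₀ hpos.le hns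
    rw [e] at hsq
    linarith [sq_nonneg m.im, sq_nonneg κ,
      show (2 - κ / 8) ^ 2 = 4 - κ / 2 + κ ^ 2 / 64 by ring]
  -- Real part of `w = -m - 1/m`. Since `|m| ≤ 1` it yields `2 |Re m| ≤ |Re w| ≤ 2 - κ`, whereas
  -- `m²` near `1` would force `(Re m)² ≥ 1 - κ/4`.
  have hw' : w.re * (m.re ^ 2 + m.im ^ 2) = - m.re * (1 + (m.re ^ 2 + m.im ^ 2)) := by
    have e1 := congrArg Complex.re hq
    have e2 := congrArg Complex.im hq
    simp at e1 e2
    linear_combination (-m.re) * e1 - m.im * e2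
  have hwsq : w.re ^ 2 ≤ (2 - κ) ^ 2 := sq_le_sq' (by linarith [neg_abs_le w.re])
    (le_trans (le_abs_self _) hre)
  set r := m.re ^ 2 + m.im ^ 2
  have h4 : w.re ^ 2 * r ^ 2 = m.re ^ 2 * (1 + r) ^ 2 := by
    have := congrArg (· ^ 2) hw'
    simp only [mul_pow] at this
    rw [this]; ring
  have h5 : 4 * r ^ 2 ≤ (1 + r) ^ 2 := by
    have : (2 * r) ^ 2 ≤ (1 + r) ^ 2 := pow_le_pow_left₀ (by positivity) (by linarith) 2
    linarith [show (2 * r) ^ 2 = 4 * r ^ 2 by ring]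
  have h6 : m.re ^ 2 * (4 * r ^ 2) ≤ (2 - κ) ^ 2 * r ^ 2 := by
    calc m.re ^ 2 * (4 * r ^ 2) ≤ m.re ^ 2 * (1 + r) ^ 2 := by gcongr
      _ = w.re ^ 2 * r ^ 2 := h4.symm
      _ ≤ _ := by gcongr
  have h7 : 4 * m.re ^ 2 ≤ (2 - κ) ^ 2 := by
    have : 0 < r ^ 2 := by positivity
    nlinarith
  -- Together `4 - κ ≤ (2 - κ)²`, that is `3 κ ≤ κ²`, which contradicts `0 < κ ≤ 2`.
  nlinarith [mul_nonneg hκ.le (sub_nonneg.2 hκ2)]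

/-! ### Sup-norm stability of `1 - q S` for stochastic `S`. -/

section Stability

variable {ι : Type*} [Fintype ι]

/-- A matrix with real entries, acting on complex vectors. -/
def complexify (S : Matrix ι ι ℝ) : Matrix ι ι ℂ := S.map fun x : ℝ => (x : ℂ)

theorem complexify_mulVec_apply (S : Matrix ι ι ℝ) (x : ι → ℂ) (i : ι) :
    (complexify S *ᵥ x) i = ∑ j, (S i j : ℂ) * x j := rfl

theorem norm_complexify_mulVec_le {S : Matrix ι ι ℝ} {c : ℝ} (hc : 0 ≤ c)
    (hS : ∀ i, ∑ j, |S i j| ≤ c) (x : ι → ℂ) : ‖complexify S *ᵥ x‖ ≤ c * ‖x‖ := by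
  refine (pi_norm_le_iff_of_nonneg (by positivity)).2 fun i => ?_
  rw [complexify_mulVec_apply]
  calc ‖∑ j, (S i j : ℂ) * x j‖ ≤ ∑ j, |S i j| * ‖x‖ := by
        refine norm_sum_le_of_le _ fun j _ => ?_
        rw [norm_mul, Complex.norm_real, Real.norm_eq_abs]
        gcongr
        exact norm_le_pi_norm x j
    _ ≤ c * ‖x‖ := by
        rw [← Finset.sum_mul]
        gcongr
        exact hS i

/-- Factor out `q` and split off the common part `ρ` of `a` and `b`: it carries the weight `1 + q`,
whose modulus falls short of `2` by `ε`. -/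
theorem norm_add_mul_le {q : ℂ} {a b ρ ε : ℝ} (hq : ‖q‖ ≤ 1) (hqε : ‖1 + q‖ ≤ 2 - ε)
    (hρ : 0 ≤ ρ) (ha : ρ ≤ a) (hb : ρ ≤ b) :
    ‖q * a + q ^ 2 * b‖ ≤ a + b - ρ * ε := by
  have h1 : q * a + q ^ 2 * b
      = q * (((a - ρ : ℝ) : ℂ) + q * ((b - ρ : ℝ) : ℂ) + ((ρ : ℝ) : ℂ) * (1 + q)) := by
    push_cast; ring
  have h2 : ‖((a - ρ : ℝ) : ℂ) + q * ((b - ρ : ℝ) : ℂ) + ((ρ : ℝ) : ℂ) * (1 + q)‖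
      ≤ (a - ρ) + 1 * (b - ρ) + ρ * (2 - ε) := by
    refine (norm_add₃_le).trans ?_
    rw [norm_mul, norm_mul, Complex.norm_real, Complex.norm_real, Complex.norm_real,
      Real.norm_of_nonneg (sub_nonneg.2 ha), Real.norm_of_nonneg (sub_nonneg.2 hb),
      Real.norm_of_nonneg hρ]
    have := sub_nonneg.2 hb
    gcongr
  rw [h1, norm_mul]
  have h3 := mul_le_mul_of_nonneg_right hq
    (norm_nonneg (((a - ρ : ℝ) : ℂ) + q * ((b - ρ : ℝ) : ℂ) + ((ρ : ℝ) : ℂ) * (1 + q)))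
  linarith

/-- If a stochastic kernel `S` and its square both dominate a kernel `ρ` of mass at least `c`, then
`1 - q S` is bounded below in sup norm for `‖q‖ ≤ 1` away from `q = 1`. -/
theorem norm_le_of_dominates [Nonempty ι] {S ρ : Matrix ι ι ℝ} {q : ℂ} {c ε : ℝ}
    (hc : 0 < c) (hε : 0 < ε) (hq : ‖q‖ ≤ 1) (hqε : ‖1 + q‖ ≤ 2 - ε)
    (hS : ∀ i j, 0 ≤ S i j) (hrow : ∀ i, ∑ j, S i j = 1) (hρ : ∀ i j, 0 ≤ ρ i j)
    (hρ1 : ∀ i j, ρ i j ≤ S i j) (hρ2 : ∀ i j, ρ i j ≤ (S * S) i j)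
    (hmass : ∀ i, c ≤ ∑ j, ρ i j) (x : ι → ℂ) :
    ‖x‖ ≤ 3 / (c * ε) * ‖x - q • (complexify S *ᵥ x)‖ := by
  set y := x - q • (complexify S *ᵥ x) with hy
  have hSS : complexify S *ᵥ (complexify S *ᵥ x) = complexify (S * S) *ᵥ x := by
    rw [Matrix.mulVec_mulVec]
    congr 1
    ext i j
    simp [complexify, Matrix.mul_apply]
  have hrow2 : ∀ i, ∑ j, (S * S) i j = 1 := fun i => by
    simp only [Matrix.mul_apply]
    rw [Finset.sum_comm]
    simp_rw [← Finset.mul_sum, hrow, mul_one, hrow]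
  have hsy : ‖complexify S *ᵥ y‖ ≤ 1 * ‖y‖ :=
    norm_complexify_mulVec_le zero_le_one (fun i => by
      simp_rw [abs_of_nonneg (hS _ _), hrow]; rfl) y
  have hpt : ∀ i, ‖x i‖ ≤ (3 * ‖y‖ + (2 - c * ε) * ‖x‖) / 2 := by
    intro i
    have e1 : q * (complexify S *ᵥ x) i + q ^ 2 * (complexify (S * S) *ᵥ x) i
        = ∑ k, (q * (S i k : ℝ) + q ^ 2 * ((S * S) i k : ℝ)) * x k := by
      simp only [complexify_mulVec_apply, Finset.mul_sum, ← Finset.sum_add_distrib]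
      exact Finset.sum_congr rfl fun k _ => by ring
    -- Sum of `x = y + q S x` and its iterate `x = y + q S y + q² S² x`. A single step would not
    -- contract when `|q| = 1`; the sum gains from the interference of `q` and `q²`.
    have e2 : 2 * x i = 2 * y i + q * (complexify S *ᵥ y) i
        + (q * (complexify S *ᵥ x) i + q ^ 2 * (complexify (S * S) *ᵥ x) i) := by
      rw [← hSS, hy, Matrix.mulVec_sub, Matrix.mulVec_smul]
      simp only [Pi.sub_apply, Pi.smul_apply, smul_eq_mul]
      ring
    have e3 : ‖∑ k, (q * (S i k : ℝ) + q ^ 2 * ((S * S) i k : ℝ)) * x k‖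
        ≤ (2 - c * ε) * ‖x‖ := by
      calc _ ≤ ∑ k, (S i k + (S * S) i k - ρ i k * ε) * ‖x‖ := by
            refine norm_sum_le_of_le _ fun k _ => ?_
            rw [norm_mul]
            gcongr
            · exact (norm_nonneg _).trans
                (norm_add_mul_le hq hqε (hρ i k) (hρ1 i k) (hρ2 i k))
            · exact norm_add_mul_le hq hqε (hρ i k) (hρ1 i k) (hρ2 i k)
            · exact norm_le_pi_norm x k
        _ ≤ _ := by
            rw [← Finset.sum_mul, Finset.sum_sub_distrib, Finset.sum_add_distrib, hrow, hrow2,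
              ← Finset.sum_mul]
            gcongr
            · norm_num
            · exact hmass i
    have e4 : ‖2 * x i‖ ≤ 2 * ‖y‖ + ‖y‖ + (2 - c * ε) * ‖x‖ := by
      rw [e2, e1]
      refine (norm_add₃_le).trans ?_
      have h1 : ‖2 * y i‖ ≤ 2 * ‖y‖ := by
        rw [norm_mul]; norm_num; exact norm_le_pi_norm y i
      have h2 : ‖q * (complexify S *ᵥ y) i‖ ≤ ‖y‖ := by
        rw [norm_mul]
        calc _ ≤ 1 * ‖complexify S *ᵥ y‖ := by
              gcongr
              exact norm_le_pi_norm (complexify S *ᵥ y) i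
          _ ≤ _ := by linarith
      linarith
    rw [norm_mul] at e4
    norm_num at e4
    linarith
  have hx := (pi_norm_le_iff_of_nonempty x).2 hpt
  rw [div_mul_eq_mul_div, le_div_iff₀ (by positivity)]
  linarith

end Stability

/-! ### The band profile satisfies the domination hypotheses. -/

theorem natAbs_valMinAbs_natCast_le (N : ℕ) [NeZero N] (a : ℕ) :
    ((a : ZMod N)).valMinAbs.natAbs ≤ a := by
  rw [ZMod.valMinAbs_natAbs_eq_min, ZMod.val_natCast]
  exact (min_le_left _ _).trans (Nat.mod_le _ _)

theorem natAbs_valMinAbs_natCast_sub_le (N : ℕ) [NeZero N] {W a b : ℕ} (ha : a ≤ W)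
    (hb : b ≤ W) : ((a : ZMod N) - b).valMinAbs.natAbs ≤ W := by
  rcases le_total b a with h | h
  · rw [← Nat.cast_sub h]
    exact (natAbs_valMinAbs_natCast_le N _).trans (by omega)
  · rw [← neg_sub, ← Nat.cast_sub h, ZMod.natAbs_valMinAbs_neg]
    exact (natAbs_valMinAbs_natCast_le N _).trans (by omega)

/-- The variance matrix of the band model without the block perturbation. -/
def bandMatrix {N : ℕ} (f : ZMod N → ℝ) : Matrix (ZMod N) (ZMod N) ℝ :=
  Matrix.of fun i j => f (i - j)

/-- The residues `i, i + 1, …, i + W - 1`. -/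
def window {N : ℕ} (W : ℕ) (i : ZMod N) : Finset (ZMod N) :=
  (Finset.range W).image fun a : ℕ => i + (a : ZMod N)

theorem mem_window {N W : ℕ} {i k : ZMod N} : k ∈ window W i ↔ ∃ a < W, i + (a : ZMod N) = k := by
  simp [window]

theorem card_window {N W : ℕ} (hW : W ≤ N) (i : ZMod N) : (window W i).card = W := by
  rw [window, Finset.card_image_of_injOn, Finset.card_range]
  intro a ha b hb hab
  have ha' : a < N := (Finset.mem_range.1 ha).trans_le hW
  have hb' : b < N := (Finset.mem_range.1 hb).trans_le hW
  have h := (ZMod.natCast_eq_natCast_iff' a b N).1 (add_left_cancel hab)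
  rwa [Nat.mod_eq_of_lt ha', Nat.mod_eq_of_lt hb'] at h

variable {N : ℕ} [NeZero N] {W : ℕ} {cs Cs : ℝ} {f : ZMod N → ℝ}

theorem IsBandProfile.sum_row (hf : IsBandProfile N W cs Cs f) (i : ZMod N) :
    ∑ j, bandMatrix f i j = 1 := by
  rw [← hf.sum_eq_one]
  exact Fintype.sum_equiv (Equiv.subLeft i) _ _ fun j => rfl

theorem IsBandProfile.le_sub (hf : IsBandProfile N W cs Cs f) {a b : ℕ} (ha : a ≤ W)
    (hb : b ≤ W) (i : ZMod N) : cs * (W : ℝ)⁻¹ ≤ bandMatrix f (i + a) (i + b) := by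
  simp only [bandMatrix, Matrix.of_apply, add_sub_add_left_eq_sub]
  exact hf.lower _ (by exact_mod_cast natAbs_valMinAbs_natCast_sub_le N ha hb)

/-- Stability of the linearized self-consistent equation in sup norm. -/
theorem IsBandProfile.stability (hf : IsBandProfile N W cs Cs f) (hcs : 0 < cs) (hW : 1 ≤ W)
    (hWN : W ≤ N) {q : ℂ} {ε : ℝ} (hε : 0 < ε) (hq : ‖q‖ ≤ 1) (hqε : ‖1 + q‖ ≤ 2 - ε)
    (x : ZMod N → ℂ) :
    ‖x‖ ≤ 3 / (min cs (cs ^ 2) * ε) * ‖x - q • (complexify (bandMatrix f) *ᵥ x)‖ := by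
  classical
  have hW0 : (0 : ℝ) < W := by exact_mod_cast hW
  have hc : 0 < min cs (cs ^ 2) := lt_min hcs (by positivity)
  have hnn : ∀ i j, 0 ≤ bandMatrix f i j := fun i j => hf.nonneg _
  -- Points of a one-sided window of length `W` are within distance `W` of each other, so there `S ≥
  -- cs / W`, and summing over intermediate points in the window gives `S² ≥ W (cs / W)² = cs² / W`.
  -- The window has exactly `W` points because `W ≤ N`, so the common mass is `min cs (cs²)`.
  refine norm_le_of_dominates (ρ := Matrix.of fun i k =>
      if k ∈ window W i then min cs (cs ^ 2) * (W : ℝ)⁻¹ else 0)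
    hc hε hq hqε hnn hf.sum_row ?_ ?_ ?_ ?_ x
  · intro i k
    simp only [Matrix.of_apply]
    split_ifs <;> positivity
  · intro i k
    simp only [Matrix.of_apply]
    split_ifs with h
    · obtain ⟨a, ha, rfl⟩ := mem_window.1 h
      have := hf.le_sub (a := 0) (b := a) (by omega) ha.le i
      simp only [Nat.cast_zero, add_zero] at this
      refine le_trans ?_ this
      gcongr
      exact min_le_left _ _
    · exact hnn _ _
  · intro i k
    simp only [Matrix.of_apply]
    split_ifs with h
    · obtain ⟨a, ha, rfl⟩ := mem_window.1 h
      rw [Matrix.mul_apply]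
      calc min cs (cs ^ 2) * (W : ℝ)⁻¹ ≤ cs ^ 2 * (W : ℝ)⁻¹ := by
            gcongr
            exact min_le_right _ _
        _ = ∑ _j ∈ window W i, (cs * (W : ℝ)⁻¹) * (cs * (W : ℝ)⁻¹) := by
            rw [Finset.sum_const, card_window hWN, nsmul_eq_mul]
            field_simp
        _ ≤ ∑ j ∈ window W i, bandMatrix f i j * bandMatrix f j (i + a) := by
            refine Finset.sum_le_sum fun j hj => ?_
            obtain ⟨b, hb, rfl⟩ := mem_window.1 hj
            have h1 := hf.le_sub (a := 0) (b := b) (by omega) hb.le i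
            simp only [Nat.cast_zero, add_zero] at h1
            have h2 := hf.le_sub hb.le ha.le i
            exact mul_le_mul h1 h2 (by positivity) (hnn _ _)
        _ ≤ _ := Finset.sum_le_sum_of_subset_of_nonneg (Finset.subset_univ _)
            fun j _ _ => mul_nonneg (hnn _ _) (hnn _ _)
    · exact Finset.sum_nonneg fun j _ => mul_nonneg (hnn _ _) (hnn _ _)
  · intro i
    simp only [Matrix.of_apply, Finset.sum_ite_mem, Finset.univ_inter, Finset.sum_const,
      card_window hWN, nsmul_eq_mul]
    apply le_of_eq
    field_simp

/-! ### Contraction argument for the self-consistent equation. -/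

section FixedPoint

variable {ι : Type*} [Fintype ι]

/-- The nonlinearity of the self-consistent equation for `x = M - m`, where `T` is the unperturbed
variance operator and `x ↦ d + L x` collects all perturbations. -/
def scNonlin (m : ℂ) (T L : (ι → ℂ) →ₗ[ℂ] (ι → ℂ)) (d x : ι → ℂ) : ι → ℂ :=
  m • (x * T x) - m • (((fun _ => m) + x) * (d + L x))

variable {m : ℂ} {T L : (ι → ℂ) →ₗ[ℂ] (ι → ℂ)} {d x y : ι → ℂ} {r a K : ℝ}

/-- The quadratic term contributes `2 r`. Each of the two products in the difference of the
perturbation terms contributes `2 a`, by `‖d + L x‖ ≤ 2 a` and `‖m + y‖ ≤ 2`. -/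
theorem norm_scNonlin_sub_le (hm : ‖m‖ ≤ 1) (hT : ∀ x, ‖T x‖ ≤ ‖x‖) (ha : 0 ≤ a)
    (hL : ∀ x, ‖L x‖ ≤ a * ‖x‖) (hd : ‖d‖ ≤ a) (hr1 : r ≤ 1) (hx : ‖x‖ ≤ r) (hy : ‖y‖ ≤ r) :
    ‖scNonlin m T L d x - scNonlin m T L d y‖ ≤ (2 * r + 4 * a) * ‖x - y‖ := by
  have hr : 0 ≤ r := (norm_nonneg x).trans hx
  have e : scNonlin m T L d x - scNonlin m T L d y
      = m • ((x * T (x - y) + (x - y) * T y)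
        - ((x - y) * (d + L x) + ((fun _ => m) + y) * L (x - y))) := by
    simp only [scNonlin, map_sub]
    rw [← smul_sub, ← smul_sub, ← smul_sub]
    congr 1
    ring
  have h1 : ‖x * T (x - y)‖ ≤ r * ‖x - y‖ := (norm_mul_le _ _).trans <| by
    gcongr
    exact hT _
  have h2 : ‖(x - y) * T y‖ ≤ ‖x - y‖ * r := (norm_mul_le _ _).trans <| by
    gcongr
    exact (hT _).trans hy
  have h3 : ‖(x - y) * (d + L x)‖ ≤ ‖x - y‖ * (a + a * 1) := (norm_mul_le _ _).trans <| by
    gcongr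
    refine (norm_add_le _ _).trans (add_le_add hd ((hL x).trans ?_))
    gcongr
    exact hx.trans hr1
  have h4 : ‖((fun _ => m) + y) * L (x - y)‖ ≤ (1 + 1) * (a * ‖x - y‖) :=
    (norm_mul_le _ _).trans <| by
      gcongr
      · exact (norm_add_le _ _).trans
          (add_le_add ((pi_norm_const_le m).trans hm) (hy.trans hr1))
      · exact hL _
  rw [e, norm_smul]
  have h5 : ‖(x * T (x - y) + (x - y) * T y)
      - ((x - y) * (d + L x) + ((fun _ => m) + y) * L (x - y))‖ ≤ (2 * r + 4 * a) * ‖x - y‖ := by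
    refine (norm_sub_le _ _).trans ?_
    have h6 := norm_add_le (x * T (x - y)) ((x - y) * T y)
    have h7 := norm_add_le ((x - y) * (d + L x)) (((fun _ => m) + y) * L (x - y))
    linarith
  calc _ ≤ 1 * _ := mul_le_mul_of_nonneg_right hm (norm_nonneg _)
    _ ≤ _ := by linarith

/-- Stability of the self-consistent equation under a perturbation `p`. -/
theorem norm_sub_le_of_scNonlin (hm : ‖m‖ ≤ 1) (hT : ∀ x, ‖T x‖ ≤ ‖x‖) (ha : 0 ≤ a)
    (hL : ∀ x, ‖L x‖ ≤ a * ‖x‖) (hd : ‖d‖ ≤ a) (hr1 : r ≤ 1) (hK : 0 ≤ K)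
    (hstab : ∀ x, ‖x‖ ≤ K * ‖x - m ^ 2 • T x‖) (hKr : K * (2 * r + 4 * a) ≤ 1 / 2)
    (hx : ‖x‖ ≤ r) (hy : ‖y‖ ≤ r) {p : ι → ℂ} (hxe : x - m ^ 2 • T x = scNonlin m T L d x)
    (hye : y - m ^ 2 • T y = scNonlin m T L d y + p) : ‖y - x‖ ≤ 2 * K * ‖p‖ := by
  have h1 := hstab (y - x)
  have e : (y - x) - m ^ 2 • T (y - x) = (scNonlin m T L d y - scNonlin m T L d x) + p := by
    rw [map_sub, smul_sub, sub_sub_sub_comm, hye, hxe]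
    abel
  have h2 := norm_scNonlin_sub_le hm hT ha hL hd hr1 hy hx
  rw [e] at h1
  have h3 : K * ‖(scNonlin m T L d y - scNonlin m T L d x) + p‖
      ≤ K * ((2 * r + 4 * a) * ‖y - x‖ + ‖p‖) := by
    gcongr
    exact (norm_add_le _ _).trans (by linarith)
  have h4 := mul_le_mul_of_nonneg_right hKr (norm_nonneg (y - x))
  nlinarith

/-- The stability bound makes `1 - m² T` injective, hence invertible in finite dimension, with
inverse of norm at most `K`. Composing the inverse with the nonlinearity gives a map that is
`1/2`-Lipschitz on the ball of radius `r` and sends `0` into the ball of radius `r / 2`. -/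
theorem exists_scNonlin_eq (hm : ‖m‖ ≤ 1) (hT : ∀ x, ‖T x‖ ≤ ‖x‖) (ha : 0 ≤ a)
    (hL : ∀ x, ‖L x‖ ≤ a * ‖x‖) (hd : ‖d‖ ≤ a) (hr0 : 0 ≤ r) (hr1 : r ≤ 1) (hK : 0 ≤ K)
    (hstab : ∀ x, ‖x‖ ≤ K * ‖x - m ^ 2 • T x‖) (hKr : K * (2 * r + 4 * a) ≤ 1 / 2)
    (hKa : K * a ≤ r / 2) :
    ∃ x, ‖x‖ ≤ r ∧ x - m ^ 2 • T x = scNonlin m T L d x := by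
  let B : (ι → ℂ) →ₗ[ℂ] (ι → ℂ) := LinearMap.id - m ^ 2 • T
  have hB : ∀ x, B x = x - m ^ 2 • T x := fun x => rfl
  have hinj : Function.Injective B := by
    refine (injective_iff_map_eq_zero B).2 fun x hx => ?_
    have := hstab x
    rw [← hB, hx, norm_zero, mul_zero] at this
    exact norm_le_zero_iff.1 this
  let e := LinearEquiv.ofInjectiveEndo B hinj
  have he : ∀ y, B (e.symm y) = y := fun y => e.apply_symm_apply y
  let F : (ι → ℂ) → (ι → ℂ) := fun x => e.symm (scNonlin m T L d x)
  have hesymm : ∀ y, ‖e.symm y‖ ≤ K * ‖y‖ := fun y => by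
    have := hstab (e.symm y)
    rwa [← hB, he] at this
  have hlip : ∀ x y, ‖x‖ ≤ r → ‖y‖ ≤ r → ‖F x - F y‖ ≤ 1 / 2 * ‖x - y‖ := by
    intro x y hx hy
    have h1 : F x - F y = e.symm (scNonlin m T L d x - scNonlin m T L d y) := (map_sub _ _ _).symm
    rw [h1]
    calc _ ≤ K * ((2 * r + 4 * a) * ‖x - y‖) := (hesymm _).trans <| by
          gcongr
          exact norm_scNonlin_sub_le hm hT ha hL hd hr1 hx hy
      _ ≤ _ := by
          rw [← mul_assoc]
          gcongr
  have hF0 : ‖F 0‖ ≤ r / 2 := by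
    refine (hesymm _).trans (le_trans ?_ hKa)
    gcongr
    simp only [scNonlin, map_zero, mul_zero, smul_zero, add_zero, zero_sub, norm_neg]
    rw [norm_smul]
    calc _ ≤ 1 * (1 * a) := by
          gcongr
          refine (norm_mul_le _ _).trans ?_
          gcongr
          exact (pi_norm_const_le m).trans hm
      _ = a := by ring
  have hmaps : Set.MapsTo F (Metric.closedBall 0 r) (Metric.closedBall 0 r) := by
    intro x hx
    rw [mem_closedBall_zero_iff] at hx ⊢
    have h1 := hlip x 0 hx (by simpa using hr0)
    rw [sub_zero] at h1
    have h2 := norm_le_norm_sub_add (F x) (F 0)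
    linarith
  have hcon : ContractingWith (1 / 2) (hmaps.restrict F _ _) := by
    refine ⟨by rw [← NNReal.coe_lt_coe]; norm_num, LipschitzWith.of_dist_le_mul fun x y => ?_⟩
    have := hlip x y (mem_closedBall_zero_iff.1 x.2) (mem_closedBall_zero_iff.1 y.2)
    rw [Subtype.dist_eq, Subtype.dist_eq, dist_eq_norm, dist_eq_norm]
    simpa using this
  obtain ⟨x, hx, hfix, -⟩ := hcon.exists_fixedPoint' Metric.isClosed_closedBall.isComplete hmaps
    (x := 0) (by simpa using hr0) (edist_ne_top _ _)
  refine ⟨x, mem_closedBall_zero_iff.1 hx, ?_⟩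
  have h := he (scNonlin m T L d x)
  have hfix' : e.symm (scNonlin m T L d x) = x := hfix
  rwa [hfix', hB] at h

end FixedPoint

/-! ### Constants, and existence, uniqueness and stability of `M`. -/

theorem sum_abs_blockSigma_le {N : ℕ} [NeZero N] {W : ℕ} (hW : 1 ≤ W) (i : ZMod N) :
    ∑ j, |blockSigma N W i j| ≤ 2 := by
  classical
  have hW0 : (0 : ℝ) < W := by exact_mod_cast hW
  have hcard : (Finset.univ.filter fun j : ZMod N => j ∈ block N W).card ≤ W := by
    have hsub : (Finset.univ.filter fun j : ZMod N => j ∈ block N W)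
        ⊆ (Finset.Icc 1 W).image fun k : ℕ => (k : ZMod N) := by
      intro j hj
      obtain ⟨k, h1, h2, rfl⟩ := (Finset.mem_filter.1 hj).2
      exact Finset.mem_image_of_mem _ (Finset.mem_Icc.2 ⟨h1, h2⟩)
    exact (Finset.card_le_card hsub).trans (Finset.card_image_le.trans (by simp))
  have hpt : ∀ j, |blockSigma N W i j|
      ≤ (if j ∈ block N W then (W : ℝ)⁻¹ else 0) + (if i = j then (W : ℝ)⁻¹ else 0) := by
    intro j
    simp only [blockSigma, Matrix.of_apply]
    by_cases hj : j ∈ block N W <;> by_cases hi : i ∈ block N W <;> by_cases hij : i = j <;>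
      simp only [hi, hj, hij, and_self, and_true, and_false, if_true, if_false, abs_zero] <;>
      first
        | positivity
        | (rw [abs_of_nonneg (by positivity)]; apply le_of_eq; ring)
  refine (Finset.sum_le_sum fun j _ => hpt j).trans ?_
  rw [Finset.sum_add_distrib, ← Finset.sum_filter, Finset.sum_const, nsmul_eq_mul,
    Finset.sum_ite_eq]
  simp only [Finset.mem_univ, if_true]
  have h1 : (1 : ℝ) ≤ W := by exact_mod_cast hW
  have h2 : ((Finset.univ.filter fun j : ZMod N => j ∈ block N W).card : ℝ) * (W : ℝ)⁻¹ ≤ 1 := by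
    rw [← div_eq_mul_inv, div_le_one hW0]
    exact_mod_cast hcard
  have h3 : (W : ℝ)⁻¹ ≤ 1 := inv_le_one_of_one_le₀ h1
  linarith

/-- The sup norm stability constant. -/
noncomputable def stabConst (κ cs : ℝ) : ℝ := max 2 (3 / (min cs (cs ^ 2) * (κ / 8)))

/-- The radius of the ball in which the self-consistent equation is solved. -/
noncomputable def solRadius (κ cs : ℝ) : ℝ := 1 / (16 * stabConst κ cs)

/-- The admissible size of the perturbation. -/
noncomputable def pertRadius (κ cs : ℝ) : ℝ := 1 / (64 * stabConst κ cs ^ 2)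

theorem two_le_stabConst (κ cs : ℝ) : 2 ≤ stabConst κ cs := le_max_left _ _

theorem solRadius_pos (κ cs : ℝ) : 0 < solRadius κ cs := by
  have := two_le_stabConst κ cs
  unfold solRadius
  positivity

theorem pertRadius_pos (κ cs : ℝ) : 0 < pertRadius κ cs := by
  have := two_le_stabConst κ cs
  unfold pertRadius
  positivity

theorem solRadius_le (κ cs : ℝ) : solRadius κ cs ≤ 1 / 32 := by
  have := two_le_stabConst κ cs
  unfold solRadius
  gcongr
  linarith

theorem pertRadius_le (κ cs : ℝ) : pertRadius κ cs ≤ 1 / 256 := by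
  have := two_le_stabConst κ cs
  unfold pertRadius
  gcongr
  nlinarith

theorem stabConst_mul_solRadius (κ cs : ℝ) : stabConst κ cs * solRadius κ cs = 1 / 16 := by
  have := two_le_stabConst κ cs
  unfold solRadius
  field_simp

/-- The perturbation terms have size `a = 2 * pertRadius`, so this is exactly the condition `K a ≤ r
/ 2` that keeps the contraction inside its ball. -/
theorem stabConst_mul_pertRadius (κ cs : ℝ) :
    stabConst κ cs * pertRadius κ cs = solRadius κ cs / 4 := by
  have := two_le_stabConst κ cs
  unfold solRadius pertRadius
  field_simp
  norm_num

section

variable {N : ℕ} [NeZero N]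

/-- The unperturbed variance operator. -/
def bandOp (f : ZMod N → ℝ) : (ZMod N → ℂ) →ₗ[ℂ] (ZMod N → ℂ) :=
  (complexify (bandMatrix f)).mulVecLin

/-- The perturbation of the variance operator. -/
noncomputable def blockOp (N W : ℕ) [NeZero N] (ζ : ℝ) : (ZMod N → ℂ) →ₗ[ℂ] (ZMod N → ℂ) :=
  (complexify (ζ • blockSigma N W)).mulVecLin

/-- The constant part of the perturbation of the self-consistent equation. -/
noncomputable def scSource (W : ℕ) (ζ : ℝ) (g : ZMod N → ℝ) (z w : ℂ) : ZMod N → ℂ :=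
  fun i => w - spectralParam N W z w i - g i + blockOp N W ζ (fun _ => msc w) i

/-- Valid for every vector `M`, not only for solutions, so that the residual of an approximate
solution becomes a perturbation of the fixed point equation. It uses only the unit row sums and `m
(-w - m) = 1`. -/
theorem scNonlin_identity {W : ℕ} {f : ZMod N → ℝ} (hf : ∀ i, ∑ j, bandMatrix f i j = 1)
    (ζ : ℝ) (g : ZMod N → ℝ) (z w : ℂ) (M : ZMod N → ℂ) (i : ZMod N) :
    let x : ZMod N → ℂ := fun j => M j - msc w
    (x - msc w ^ 2 • bandOp f x
      - scNonlin (msc w) (bandOp f) (blockOp N W ζ) (scSource W ζ g z w) x) i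
    = msc w * (M i * (-spectralParam N W z w i - (g i : ℂ)
        - ∑ j, (varMatrix N W f ζ i j : ℂ) * M j) - 1) := by
  intro x
  have hT : bandOp f x i = ∑ j, (bandMatrix f i j : ℂ) * M j - msc w := by
    have h1 : ∑ j, (bandMatrix f i j : ℂ) = 1 := by exact_mod_cast hf i
    change ∑ j, (bandMatrix f i j : ℂ) * (M j - msc w) = _
    simp_rw [mul_sub]
    rw [Finset.sum_sub_distrib, ← Finset.sum_mul, h1, one_mul]
  have hL : blockOp N W ζ (fun _ => msc w) i + blockOp N W ζ x i
      = ∑ j, ((ζ • blockSigma N W) i j : ℂ) * M j := by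
    rw [← Pi.add_apply, ← map_add]
    change ∑ j, ((ζ • blockSigma N W) i j : ℂ) * (msc w + (M j - msc w)) = _
    simp
  have hS : ∑ j, (varMatrix N W f ζ i j : ℂ) * M j
      = ∑ j, (bandMatrix f i j : ℂ) * M j - ∑ j, ((ζ • blockSigma N W) i j : ℂ) * M j := by
    rw [← Finset.sum_sub_distrib]
    refine Finset.sum_congr rfl fun j _ => ?_
    rw [← sub_mul, ← Complex.ofReal_sub]
    rfl
  have hq := msc_quadratic w
  simp only [Pi.sub_apply, Pi.smul_apply, smul_eq_mul, scNonlin, Pi.mul_apply, Pi.add_apply,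
    scSource]
  rw [hS, ← hL, hT]
  simp only [x]
  linear_combination (-M i) * hq

variable {κ cs Cs c₀ : ℝ} {W : ℕ} {f : ZMod N → ℝ} {ζ : ℝ} {g : ZMod N → ℝ} {z w : ℂ}

theorem norm_bandOp_le (hf : IsBandProfile N W cs Cs f) (x : ZMod N → ℂ) :
    ‖bandOp f x‖ ≤ ‖x‖ := by
  have h := norm_complexify_mulVec_le (S := bandMatrix f) zero_le_one (fun i => by
    have : ∀ j, |bandMatrix f i j| = bandMatrix f i j := fun j => abs_of_nonneg (hf.nonneg _)
    simp_rw [this]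
    exact (hf.sum_row i).le) x
  rwa [one_mul] at h

theorem norm_blockOp_le (hW : 1 ≤ W) (hζ : 0 ≤ ζ) (x : ZMod N → ℂ) :
    ‖blockOp N W ζ x‖ ≤ (2 * ζ) * ‖x‖ := by
  refine norm_complexify_mulVec_le (by positivity) (fun i => ?_) x
  have := sum_abs_blockSigma_le (N := N) hW i
  simp only [Matrix.smul_apply, smul_eq_mul, abs_mul, abs_of_nonneg hζ]
  rw [← Finset.mul_sum, mul_comm 2]
  gcongr

theorem IsAdmissible.norm_scSource_le (h : IsAdmissible κ cs Cs c₀ N W f ζ g z w) :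
    ‖scSource W ζ g z w‖ ≤ 2 * c₀ := by
  have hs := h.small
  have hg := norm_nonneg g
  have hzw := norm_nonneg (z - w)
  have hζ := h.zeta_nonneg
  refine (pi_norm_le_iff_of_nonneg (by linarith)).2 fun i => ?_
  have h1 : ‖w - spectralParam N W z w i‖ ≤ ‖z - w‖ := by
    unfold spectralParam
    split_ifs
    · rw [norm_sub_rev]
    · simp
  have h2 : ‖(g i : ℂ)‖ ≤ ‖g‖ := by
    rw [Complex.norm_real]
    exact norm_le_pi_norm g i
  have h3 : ‖blockOp N W ζ (fun _ => msc w) i‖ ≤ 2 * ζ := by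
    refine (norm_le_pi_norm _ i).trans ((norm_blockOp_le h.one_le hζ _).trans ?_)
    have := (pi_norm_const_le (ι := ZMod N) (msc w)).trans (norm_msc_le_one h.im_w_nonneg)
    nlinarith
  have h4 := norm_sub_le (w - spectralParam N W z w i) (g i : ℂ)
  have h5 := norm_add_le (w - spectralParam N W z w i - (g i : ℂ))
    (blockOp N W ζ (fun _ => msc w) i)
  change ‖w - spectralParam N W z w i - (g i : ℂ) + blockOp N W ζ (fun _ => msc w) i‖ ≤ _
  linarith

theorem IsAdmissible.norm_blockOp_le (h : IsAdmissible κ cs Cs c₀ N W f ζ g z w)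
    (x : ZMod N → ℂ) : ‖blockOp N W ζ x‖ ≤ (2 * c₀) * ‖x‖ := by
  refine (BandMatrix.norm_blockOp_le h.one_le h.zeta_nonneg x).trans ?_
  have hs := h.small
  have hg := norm_nonneg g
  have hzw := norm_nonneg (z - w)
  gcongr
  linarith

theorem IsAdmissible.stability (hκ : 0 < κ) (hcs : 0 < cs)
    (h : IsAdmissible κ cs Cs c₀ N W f ζ g z w) (x : ZMod N → ℂ) :
    ‖x‖ ≤ stabConst κ cs * ‖x - msc w ^ 2 • bandOp f x‖ := by
  have hm := norm_msc_le_one h.im_w_nonneg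
  refine (h.profile.stability hcs h.one_le h.le_size (q := msc w ^ 2) (ε := κ / 8) (by positivity)
    ?_ (norm_one_add_msc_sq_le hκ h.im_w_nonneg h.re_w_le) x).trans ?_
  · rw [norm_pow]
    exact pow_le_one₀ (norm_nonneg _) hm
  · exact mul_le_mul_of_nonneg_right (le_max_right _ _) (norm_nonneg _)

/-- Used twice: with `b = 0` for uniqueness, and with the diagonal of the resolvent as `y`. The
radius is doubled because that diagonal is close to `M`, which is itself only within `solRadius` of
`msc w`. -/
theorem IsAdmissible.norm_sub_le (hκ : 0 < κ) (hcs : 0 < cs)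
    (h : IsAdmissible κ cs Cs (pertRadius κ cs) N W f ζ g z w) {M y : ZMod N → ℂ}
    (hM : IsSelfConsistent W (varMatrix N W f ζ) g z w (solRadius κ cs) M)
    (hy : ∀ i, ‖y i - msc w‖ ≤ 2 * solRadius κ cs) {b : ℝ} (hb : 0 ≤ b)
    (hyb : ∀ i, ‖y i * (-spectralParam N W z w i - (g i : ℂ)
        - ∑ j, (varMatrix N W f ζ i j : ℂ) * y j) - 1‖ ≤ b) (i : ZMod N) :
    ‖y i - M i‖ ≤ 2 * stabConst κ cs * b := by
  have hK := two_le_stabConst κ cs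
  have hr0 := solRadius_pos κ cs
  have hr := solRadius_le κ cs
  have ha0 := pertRadius_pos κ cs
  have hKr := stabConst_mul_solRadius κ cs
  have hKa := stabConst_mul_pertRadius κ cs
  have hm := norm_msc_le_one h.im_w_nonneg
  have hMx : ‖fun j => M j - msc w‖ ≤ 2 * solRadius κ cs :=
    (pi_norm_le_iff_of_nonneg (by positivity)).2 fun j => (hM.near j).trans (by linarith)
  have hyx : ‖fun j => y j - msc w‖ ≤ 2 * solRadius κ cs :=
    (pi_norm_le_iff_of_nonneg (by positivity)).2 hy
  have hxe := scNonlin_identity (W := W) h.profile.sum_row ζ g z w M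
  have hye := scNonlin_identity (W := W) h.profile.sum_row ζ g z w y
  simp only at hxe hye
  set p : ZMod N → ℂ := fun i => msc w * (y i * (-spectralParam N W z w i - (g i : ℂ)
        - ∑ j, (varMatrix N W f ζ i j : ℂ) * y j) - 1) with hp
  have hpb : ‖p‖ ≤ b := by
    refine (pi_norm_le_iff_of_nonneg hb).2 fun j => ?_
    rw [hp, norm_mul]
    have := hyb j
    calc _ ≤ 1 * b := by gcongr
      _ = b := one_mul b
  have key := norm_sub_le_of_scNonlin (p := p) hm (norm_bandOp_le h.profile)
    (a := 2 * pertRadius κ cs) (by positivity) h.norm_blockOp_le h.norm_scSource_le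
    (r := 2 * solRadius κ cs) (by linarith) (by linarith) (h.stability hκ hcs)
    (by linarith [show stabConst κ cs * (2 * (2 * solRadius κ cs) + 4 * (2 * pertRadius κ cs))
      = 4 * (stabConst κ cs * solRadius κ cs) + 8 * (stabConst κ cs * pertRadius κ cs) by ring])
    hMx hyx
    (by
      refine sub_eq_zero.1 (funext fun i => ?_)
      rw [hxe, ← hM.eqn, mul_inv_cancel₀ (hM.ne_zero i), sub_self, mul_zero]
      rfl)
    (by
      rw [← sub_eq_iff_eq_add']
      exact funext hye)
  have h1 := norm_le_pi_norm ((fun j => y j - msc w) - fun j => M j - msc w) i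
  simp only [Pi.sub_apply, sub_sub_sub_cancel_right] at h1
  calc _ ≤ _ := h1
    _ ≤ _ := key
    _ ≤ _ := by gcongr

theorem IsAdmissible.existsUnique (hκ : 0 < κ) (hcs : 0 < cs)
    (h : IsAdmissible κ cs Cs (pertRadius κ cs) N W f ζ g z w) :
    ∃! M : ZMod N → ℂ, IsSelfConsistent W (varMatrix N W f ζ) g z w (solRadius κ cs) M := by
  have hK := two_le_stabConst κ cs
  have hr0 := solRadius_pos κ cs
  have hr := solRadius_le κ cs
  have ha0 := pertRadius_pos κ cs
  have hKr := stabConst_mul_solRadius κ cs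
  have hKa := stabConst_mul_pertRadius κ cs
  have hm := norm_msc_le_one h.im_w_nonneg
  obtain ⟨x, hx, hxe⟩ := exists_scNonlin_eq hm (norm_bandOp_le h.profile)
    (a := 2 * pertRadius κ cs) (by positivity) h.norm_blockOp_le h.norm_scSource_le
    hr0.le (by linarith) (by linarith) (h.stability hκ hcs)
    (by linarith [show stabConst κ cs * (2 * solRadius κ cs + 4 * (2 * pertRadius κ cs))
      = 2 * (stabConst κ cs * solRadius κ cs) + 8 * (stabConst κ cs * pertRadius κ cs) by ring])
    (by linarith [show stabConst κ cs * (2 * pertRadius κ cs)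
      = 2 * (stabConst κ cs * pertRadius κ cs) by ring])
  have heq : ∀ i, (msc w + x i) * (-spectralParam N W z w i - (g i : ℂ)
        - ∑ j, (varMatrix N W f ζ i j : ℂ) * (msc w + x j)) = 1 := by
    intro i
    have h1 := scNonlin_identity (W := W) h.profile.sum_row ζ g z w (fun j => msc w + x j) i
    simp only [add_sub_cancel_left] at h1
    have h2 : (x - msc w ^ 2 • bandOp f x
      - scNonlin (msc w) (bandOp f) (blockOp N W ζ) (scSource W ζ g z w) x) i = 0 := by
      rw [hxe, sub_self]; rfl
    rw [show (fun j => x j) = x from rfl, h2] at h1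
    exact sub_eq_zero.1 ((mul_eq_zero.1 h1.symm).resolve_left (msc_ne_zero w))
  have hM' : IsSelfConsistent W (varMatrix N W f ζ) g z w (solRadius κ cs)
      (fun j => msc w + x j) :=
    ⟨fun i => left_ne_zero_of_mul_eq_one (heq i),
      fun i => inv_eq_of_mul_eq_one_right (heq i), fun i => by
        simp only [add_sub_cancel_left]
        exact (norm_le_pi_norm x i).trans hx⟩
  refine ⟨_, hM', fun M hM => funext fun i => ?_⟩
  have h1 := h.norm_sub_le hκ hcs hM' (y := M) (fun j => (hM.near j).trans (by linarith)) le_rfl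
    (fun j => by rw [← hM.eqn, mul_inv_cancel₀ (hM.ne_zero j), sub_self, norm_zero]) i
  rw [mul_zero] at h1
  exact sub_eq_zero.1 (norm_le_zero_iff.1 h1)

end

/-! ### Resolvent of the minor and Schur complement identities. -/

section Minor

variable {ι : Type*} [Fintype ι] [DecidableEq ι]

/-- The matrix `A` with row and column `i` replaced by those of the identity. -/
def minorMatrix {R : Type*} [Zero R] [One R] (A : Matrix ι ι R) (i : ι) : Matrix ι ι R :=
  Matrix.of fun k l => if k = i ∨ l = i then (if k = l then 1 else 0) else A k l

variable {A : Matrix ι ι ℂ} {i : ι}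

/-- The rank-one corrected inverse vanishes on row and column `i` before the last term restores the
entry at `(i, i)`. Checking that it is a right inverse also proves the minor invertible. The index
set stays fixed, which avoids subtypes. -/
theorem inv_minorMatrix (hA : IsUnit A) (hi : A⁻¹ i i ≠ 0) (k l : ι) :
    (minorMatrix A i)⁻¹ k l
      = A⁻¹ k l - A⁻¹ k i * A⁻¹ i l / A⁻¹ i i + if k = i ∧ l = i then 1 else 0 := by
  have hAG : A * A⁻¹ = 1 := Matrix.mul_nonsing_inv A ((Matrix.isUnit_iff_isUnit_det A).1 hA)
  generalize A⁻¹ = G at *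
  have hR : (minorMatrix A i)⁻¹
      = Matrix.of fun k l => G k l - G k i * G i l / G i i + if k = i ∧ l = i then 1 else 0 := by
    refine Matrix.inv_eq_right_inv ?_
    ext k l
    rw [Matrix.mul_apply]
    by_cases hk : k = i
    · subst hk
      have h1 : ∀ j, minorMatrix A k k j = if k = j then 1 else 0 := fun j => by
        simp [minorMatrix]
      simp only [h1, ite_mul, one_mul, zero_mul, Finset.sum_ite_eq, Finset.mem_univ, if_true,
        Matrix.of_apply, true_and]
      rw [mul_div_assoc, mul_div_cancel₀ _ hi, sub_self, zero_add, Matrix.one_apply]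
      simp only [eq_comm]
    · have h1 : ∀ j, minorMatrix A i k j * (G j l - G j i * G i l / G i i
          + if j = i ∧ l = i then 1 else 0) = A k j * (G j l - G j i * G i l / G i i) := fun j => by
        by_cases hj : j = i
        · subst hj
          rw [mul_div_assoc, mul_div_cancel₀ _ hi, sub_self, mul_zero]
          simp [minorMatrix, hk]
        · simp [minorMatrix, hk, hj]
      simp only [Matrix.of_apply, h1]
      have h2 : ∑ j, A k j * (G j l - G j i * G i l / G i i)
          = (A * G) k l - (A * G) k i * (G i l / G i i) := by
        simp only [Matrix.mul_apply, Finset.sum_mul, ← Finset.sum_sub_distrib]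
        exact Finset.sum_congr rfl fun j _ => by ring
      rw [h2, hAG, Matrix.one_apply_ne hk, zero_mul, sub_zero]
  rw [hR]
  rfl

theorem inv_minorMatrix_of_ne (hA : IsUnit A) (hi : A⁻¹ i i ≠ 0) {k : ι} (hk : k ≠ i) (l : ι) :
    (minorMatrix A i)⁻¹ k l = A⁻¹ k l - A⁻¹ k i * A⁻¹ i l / A⁻¹ i i := by
  rw [inv_minorMatrix hA hi, if_neg (fun h => hk h.1), add_zero]

theorem sum_mul_inv_minorMatrix (hA : IsUnit A) (hi : A⁻¹ i i ≠ 0) {j : ι} (hj : j ≠ i) :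
    ∑ k ∈ Finset.univ.erase i, A i k * (minorMatrix A i)⁻¹ k j = -(A⁻¹ i j / A⁻¹ i i) := by
  have hAG : A * A⁻¹ = 1 := Matrix.mul_nonsing_inv A ((Matrix.isUnit_iff_isUnit_det A).1 hA)
  have h1 : ∑ k ∈ Finset.univ.erase i, A i k * (minorMatrix A i)⁻¹ k j
      = ∑ k ∈ Finset.univ.erase i, A i k * (A⁻¹ k j - A⁻¹ k i * A⁻¹ i j / A⁻¹ i i) :=
    Finset.sum_congr rfl fun k hk => by
      rw [inv_minorMatrix_of_ne hA hi (Finset.ne_of_mem_erase hk)]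
  have h2 : ∑ k, A i k * (A⁻¹ k j - A⁻¹ k i * A⁻¹ i j / A⁻¹ i i)
      = (A * A⁻¹) i j - (A * A⁻¹) i i * (A⁻¹ i j / A⁻¹ i i) := by
    simp only [Matrix.mul_apply, Finset.sum_mul, ← Finset.sum_sub_distrib]
    exact Finset.sum_congr rfl fun j _ => by ring
  -- The corrected expression is zero at `k = i`, so the sum extends to all `k` and `A * A⁻¹ = 1`
  -- applies.
  rw [h1, Finset.sum_erase, h2, hAG, Matrix.one_apply_ne hj.symm, Matrix.one_apply_eq]
  · ring
  · rw [mul_div_assoc, mul_div_cancel₀ _ hi, sub_self, mul_zero]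

theorem sum_mul_inv_minorMatrix_mul (hA : IsUnit A) (hi : A⁻¹ i i ≠ 0) :
    ∑ k ∈ Finset.univ.erase i, ∑ l ∈ Finset.univ.erase i,
      A i k * A l i * (minorMatrix A i)⁻¹ k l = A i i - (A⁻¹ i i)⁻¹ := by
  have hGA : A⁻¹ * A = 1 := Matrix.nonsing_inv_mul A ((Matrix.isUnit_iff_isUnit_det A).1 hA)
  rw [Finset.sum_comm]
  have h1 : ∀ l ∈ Finset.univ.erase i, ∑ k ∈ Finset.univ.erase i,
      A i k * A l i * (minorMatrix A i)⁻¹ k l = -(A⁻¹ i l * A l i) / A⁻¹ i i := by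
    intro l hl
    calc _ = (∑ k ∈ Finset.univ.erase i, A i k * (minorMatrix A i)⁻¹ k l) * A l i := by
          rw [Finset.sum_mul]
          exact Finset.sum_congr rfl fun k _ => by ring
      _ = _ := by
          rw [sum_mul_inv_minorMatrix hA hi (Finset.ne_of_mem_erase hl)]
          ring
  rw [Finset.sum_congr rfl h1, ← Finset.sum_div, Finset.sum_neg_distrib]
  have h2 : ∑ l ∈ Finset.univ.erase i, A⁻¹ i l * A l i = 1 - A⁻¹ i i * A i i := by
    have h3 : (A⁻¹ * A) i i = 1 := by rw [hGA, Matrix.one_apply_eq]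
    rw [Matrix.mul_apply, ← Finset.sum_erase_add _ _ (Finset.mem_univ i)] at h3
    linear_combination h3
  rw [h2]
  field_simp
  ring

theorem norm_sub_sq_le (a b : ℂ) : ‖a - b‖ ^ 2 ≤ 2 * ‖a‖ ^ 2 + 2 * ‖b‖ ^ 2 := by
  have h1 := norm_sub_le a b
  have h2 := norm_nonneg (a - b)
  nlinarith [sq_nonneg (‖a‖ - ‖b‖)]

/-- The weight `‖A⁻¹ i i‖²` cancels the denominator, so no lower bound on the diagonal entry is
needed; none is available uniformly, since `Im w` may be large. -/
theorem norm_mul_inv_minorMatrix_sq_le (hA : IsUnit A) (hi : A⁻¹ i i ≠ 0) {k : ι} (hk : k ≠ i)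
    (l : ι) : ‖A⁻¹ i i‖ ^ 2 * ‖(minorMatrix A i)⁻¹ k l‖ ^ 2
      ≤ 2 * (‖A⁻¹ i i‖ ^ 2 * ‖A⁻¹ k l‖ ^ 2) + 2 * (‖A⁻¹ k i‖ ^ 2 * ‖A⁻¹ i l‖ ^ 2) := by
  rw [inv_minorMatrix_of_ne hA hi hk, ← mul_pow, ← norm_mul, mul_sub, mul_div_cancel₀ _ hi]
  refine (norm_sub_sq_le _ _).trans_eq ?_
  simp only [norm_mul, mul_pow]

end Minor

/-! ### Conditional variances of the linear and quadratic forms. -/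

section Bounds

variable {ι : Type*} [Fintype ι] [DecidableEq ι] {A : Matrix ι ι ℂ} {i : ι} {S : Matrix ι ι ℝ}
  {Φ : ℝ}

/-- Passing from the minor to the full inverse costs one extra column: columns `j` and `i` of `T`
each contribute `8 Φ²`. -/
theorem variance_linear_le (hA : IsUnit A) (hi : A⁻¹ i i ≠ 0) (hG : ∀ k l, ‖A⁻¹ k l‖ ≤ 2)
    (hS : ∀ i j, 0 ≤ S i j) (hT : ∀ j, ∑ k, S i k * ‖A⁻¹ k j‖ ^ 2 ≤ Φ ^ 2) (j : ι) :
    ‖A⁻¹ i i‖ ^ 2 * ∑ k ∈ Finset.univ.erase i, S i k * ‖(minorMatrix A i)⁻¹ k j‖ ^ 2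
      ≤ 16 * Φ ^ 2 := by
  have hG2 : ∀ k l, ‖A⁻¹ k l‖ ^ 2 ≤ 4 := fun k l => by
    have := pow_le_pow_left₀ (norm_nonneg _) (hG k l) 2
    linarith
  calc _ = ∑ k ∈ Finset.univ.erase i,
        S i k * (‖A⁻¹ i i‖ ^ 2 * ‖(minorMatrix A i)⁻¹ k j‖ ^ 2) := by
        rw [Finset.mul_sum]
        exact Finset.sum_congr rfl fun k _ => by ring
    _ ≤ ∑ k ∈ Finset.univ.erase i, S i k * (2 * (4 * ‖A⁻¹ k j‖ ^ 2) + 2 * (‖A⁻¹ k i‖ ^ 2 * 4)) := by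
        refine Finset.sum_le_sum fun k hk => mul_le_mul_of_nonneg_left ?_ (hS i k)
        refine (norm_mul_inv_minorMatrix_sq_le hA hi (Finset.ne_of_mem_erase hk) j).trans ?_
        gcongr
        · exact hG2 i i
        · exact hG2 i j
    _ ≤ ∑ k, S i k * (2 * (4 * ‖A⁻¹ k j‖ ^ 2) + 2 * (‖A⁻¹ k i‖ ^ 2 * 4)) :=
        Finset.sum_le_sum_of_subset_of_nonneg (Finset.subset_univ _)
          fun k _ _ => mul_nonneg (hS i k) (by positivity)
    _ = 8 * ∑ k, S i k * ‖A⁻¹ k j‖ ^ 2 + 8 * ∑ k, S i k * ‖A⁻¹ k i‖ ^ 2 := by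
        rw [Finset.mul_sum, Finset.mul_sum, ← Finset.sum_add_distrib]
        exact Finset.sum_congr rfl fun k _ => by ring
    _ ≤ _ := by linarith [hT j, hT i]

theorem variance_quadratic_le (hA : IsUnit A) (hi : A⁻¹ i i ≠ 0) (hG : ∀ k l, ‖A⁻¹ k l‖ ≤ 2)
    (hS : ∀ i j, 0 ≤ S i j) (hrow : ∑ j, S i j ≤ 1)
    (hT : ∀ j, ∑ k, S i k * ‖A⁻¹ k j‖ ^ 2 ≤ Φ ^ 2) :
    ‖A⁻¹ i i‖ ^ 2 * ∑ k ∈ Finset.univ.erase i, ∑ l ∈ Finset.univ.erase i,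
      S i k * S i l * ‖(minorMatrix A i)⁻¹ k l‖ ^ 2 ≤ 16 * Φ ^ 2 := by
  rw [Finset.sum_comm]
  calc _ = ∑ l ∈ Finset.univ.erase i, S i l * (‖A⁻¹ i i‖ ^ 2 *
        ∑ k ∈ Finset.univ.erase i, S i k * ‖(minorMatrix A i)⁻¹ k l‖ ^ 2) := by
        simp only [Finset.mul_sum]
        exact Finset.sum_congr rfl fun l _ => Finset.sum_congr rfl fun k _ => by ring
    _ ≤ ∑ l ∈ Finset.univ.erase i, S i l * (16 * Φ ^ 2) :=
        Finset.sum_le_sum fun l _ =>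
          mul_le_mul_of_nonneg_left (variance_linear_le hA hi hG hS hT l) (hS i l)
    _ ≤ ∑ l, S i l * (16 * Φ ^ 2) :=
        Finset.sum_le_sum_of_subset_of_nonneg (Finset.subset_univ _)
          fun k _ _ => mul_nonneg (hS i k) (by positivity)
    _ ≤ _ := by
        rw [← Finset.sum_mul]
        have : 0 ≤ 16 * Φ ^ 2 := by positivity
        nlinarith

theorem variance_diagonal_le (hA : IsUnit A) (hi : A⁻¹ i i ≠ 0) (hG : ∀ k l, ‖A⁻¹ k l‖ ≤ 2)
    (hS : ∀ i j, 0 ≤ S i j) (hrow : ∑ j, S i j ≤ 1) {b : ℝ} (hb : 0 ≤ b)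
    (hSb : ∀ j, S i j ≤ b) :
    ‖A⁻¹ i i‖ ^ 2 * ∑ k ∈ Finset.univ.erase i, S i k ^ 2 * ‖(minorMatrix A i)⁻¹ k k‖ ^ 2
      ≤ 64 * b := by
  have hG2 : ∀ k l, ‖A⁻¹ k l‖ ^ 2 ≤ 4 := fun k l => by
    have := pow_le_pow_left₀ (norm_nonneg _) (hG k l) 2
    linarith
  calc _ = ∑ k ∈ Finset.univ.erase i,
        S i k ^ 2 * (‖A⁻¹ i i‖ ^ 2 * ‖(minorMatrix A i)⁻¹ k k‖ ^ 2) := by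
        rw [Finset.mul_sum]
        exact Finset.sum_congr rfl fun k _ => by ring
    _ ≤ ∑ k ∈ Finset.univ.erase i, (S i k * b) * (2 * (4 * 4) + 2 * (4 * 4)) := by
        refine Finset.sum_le_sum fun k hk => mul_le_mul ?_ ?_ (by positivity)
          (mul_nonneg (hS i k) hb)
        · rw [pow_two]
          exact mul_le_mul_of_nonneg_left (hSb k) (hS i k)
        refine (norm_mul_inv_minorMatrix_sq_le hA hi (Finset.ne_of_mem_erase hk) k).trans ?_
        gcongr <;> exact hG2 _ _
    _ ≤ ∑ k, (S i k * b) * (2 * (4 * 4) + 2 * (4 * 4)) :=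
        Finset.sum_le_sum_of_subset_of_nonneg (Finset.subset_univ _)
          fun k _ _ => mul_nonneg (mul_nonneg (hS i k) hb) (by norm_num)
    _ ≤ _ := by
        rw [← Finset.sum_mul, ← Finset.sum_mul]
        nlinarith

theorem inv_apply_comm (hsymm : ∀ k l, A k l = A l k) (k l : ι) : A⁻¹ k l = A⁻¹ l k := by
  have h : Aᵀ = A := Matrix.ext fun a b => hsymm b a
  have h2 := Matrix.transpose_nonsing_inv A
  rw [h] at h2
  exact (congrFun (congrFun h2 l) k)

/-- The equation for the diagonal resolvent entries given by Schur's complement formula. -/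
theorem diagonal_equation (hA : IsUnit A) (hi : A⁻¹ i i ≠ 0) (hsymm : ∀ k l, A k l = A l k) :
    A⁻¹ i i * (A i i - ∑ k, (S i k : ℂ) * A⁻¹ k k) - 1
      = A⁻¹ i i * (∑ k ∈ Finset.univ.erase i, ∑ l ∈ (Finset.univ.erase i).erase k,
            A i k * A i l * (minorMatrix A i)⁻¹ k l)
        + A⁻¹ i i * (∑ k ∈ Finset.univ.erase i,
            (A i k ^ 2 - (S i k : ℂ)) * (minorMatrix A i)⁻¹ k k)
        - ∑ k, (S i k : ℂ) * A⁻¹ k i ^ 2 := by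
  have h1 := sum_mul_inv_minorMatrix_mul hA hi
  -- Replacing the minor's diagonal by that of `A⁻¹` produces, by symmetry of `A⁻¹`, the error `∑
  -- S_ik (A⁻¹ k i)² / A⁻¹ i i`, which is controlled by `T`.
  have h2 : ∑ k ∈ Finset.univ.erase i, (S i k : ℂ) * (minorMatrix A i)⁻¹ k k
      = ∑ k, (S i k : ℂ) * A⁻¹ k k - (∑ k, (S i k : ℂ) * A⁻¹ k i ^ 2) / A⁻¹ i i := by
    calc _ = ∑ k ∈ Finset.univ.erase i, (S i k : ℂ) * (A⁻¹ k k - A⁻¹ k i * A⁻¹ i k / A⁻¹ i i) :=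
          Finset.sum_congr rfl fun k hk => by
            rw [inv_minorMatrix_of_ne hA hi (Finset.ne_of_mem_erase hk)]
      _ = ∑ k, (S i k : ℂ) * (A⁻¹ k k - A⁻¹ k i * A⁻¹ i k / A⁻¹ i i) := by
          rw [Finset.sum_erase]
          rw [mul_div_assoc, mul_div_cancel₀ _ hi, sub_self, mul_zero]
      _ = _ := by
          rw [Finset.sum_div, ← Finset.sum_sub_distrib]
          refine Finset.sum_congr rfl fun k _ => ?_
          rw [inv_apply_comm hsymm i k]
          ring
  have h3 : ∑ k ∈ Finset.univ.erase i, ∑ l ∈ Finset.univ.erase i,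
      A i k * A l i * (minorMatrix A i)⁻¹ k l
      = ∑ k ∈ Finset.univ.erase i, ∑ l ∈ (Finset.univ.erase i).erase k,
            A i k * A i l * (minorMatrix A i)⁻¹ k l
        + ∑ k ∈ Finset.univ.erase i, A i k ^ 2 * (minorMatrix A i)⁻¹ k k := by
    rw [← Finset.sum_add_distrib]
    refine Finset.sum_congr rfl fun k hk => ?_
    rw [← Finset.sum_erase_add _ _ hk, hsymm k i, pow_two]
    congr 1
    exact Finset.sum_congr rfl fun l _ => by rw [hsymm l i]
  have h4 : ∑ k ∈ Finset.univ.erase i, (A i k ^ 2 - (S i k : ℂ)) * (minorMatrix A i)⁻¹ k k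
      = ∑ k ∈ Finset.univ.erase i, A i k ^ 2 * (minorMatrix A i)⁻¹ k k
        - ∑ k ∈ Finset.univ.erase i, (S i k : ℂ) * (minorMatrix A i)⁻¹ k k := by
    simp_rw [sub_mul]
    rw [Finset.sum_sub_distrib]
  rw [h3] at h1
  rw [h4, h2]
  have h5 : A⁻¹ i i * (A⁻¹ i i)⁻¹ = 1 := mul_inv_cancel₀ hi
  rw [div_eq_mul_inv]
  linear_combination (-A⁻¹ i i) * h1 + (1 - ∑ k, (S i k : ℂ) * A⁻¹ k i ^ 2) * h5

end Bounds

/-! ### Diagonal resolvent entries do not vanish in the upper half plane. -/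

section Positivity

variable {ι : Type*} [Fintype ι] [DecidableEq ι]

/-- A diagonal resolvent entry does not vanish when all spectral parameters lie in the open upper
half plane. -/
theorem inv_apply_self_ne_zero {B : Matrix ι ι ℝ} (hB : ∀ i j, B i j = B j i) {s : ι → ℂ}
    (hs : ∀ i, 0 < (s i).im) (hA : IsUnit (complexify B - Matrix.diagonal s)) (i : ι) :
    (complexify B - Matrix.diagonal s)⁻¹ i i ≠ 0 := by
  intro h0
  set A := complexify B - Matrix.diagonal s with hAdef
  have hAG : A * A⁻¹ = 1 := Matrix.mul_nonsing_inv A ((Matrix.isUnit_iff_isUnit_det A).1 hA)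
  set x : ι → ℂ := fun k => A⁻¹ k i with hx
  have hAx : ∀ k, ∑ l, A k l * x l = (1 : Matrix ι ι ℂ) k i := fun k => by
    rw [← hAG, Matrix.mul_apply]
  -- With `x` the `i`-th column of `A⁻¹`, the form `x* A x` equals the conjugate of `x i = 0`. Its
  -- imaginary part is `-∑ Im (s k) |x k|²`, so `x = 0`, against `A x = e_i`.
  have hform : ∑ k, (starRingEnd ℂ) (x k) * ∑ l, A k l * x l = 0 := by
    refine Finset.sum_eq_zero fun k _ => ?_
    rw [hAx]
    by_cases hk : k = i
    · subst hk
      simp [hx, h0]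
    · rw [Matrix.one_apply_ne hk, mul_zero]
  have hsplit : ∑ k, (starRingEnd ℂ) (x k) * ∑ l, A k l * x l
      = ∑ k, ∑ l, (starRingEnd ℂ) (x k) * ((B k l : ℂ) * x l)
        - ∑ k, s k * (Complex.normSq (x k) : ℂ) := by
    rw [← Finset.sum_sub_distrib]
    refine Finset.sum_congr rfl fun k _ => ?_
    have : ∑ l, A k l * x l = ∑ l, (B k l : ℂ) * x l - s k * x k := by
      simp only [hAdef, Matrix.sub_apply, sub_mul, Finset.sum_sub_distrib, Matrix.diagonal_apply,
        ite_mul, zero_mul, Finset.sum_ite_eq, Finset.mem_univ, if_true]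
      rfl
    rw [this, mul_sub, Finset.mul_sum, Complex.normSq_eq_conj_mul_self]
    ring
  have hreal : (∑ k, ∑ l, (starRingEnd ℂ) (x k) * ((B k l : ℂ) * x l)).im = 0 := by
    rw [← Complex.conj_eq_iff_im]
    simp only [map_sum, map_mul, Complex.conj_conj, Complex.conj_ofReal]
    rw [Finset.sum_comm]
    refine Finset.sum_congr rfl fun l _ => Finset.sum_congr rfl fun k _ => ?_
    rw [hB k l]
    ring
  have him := congrArg Complex.im hform
  rw [hsplit, Complex.sub_im, hreal, Complex.im_sum] at him
  simp only [Complex.im_mul_ofReal, Complex.zero_im, zero_sub, neg_eq_zero] at him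
  have hx0 : ∀ k, x k = 0 := fun k => by
    have h1 := (Finset.sum_eq_zero_iff_of_nonneg fun k _ =>
      mul_nonneg (hs k).le (Complex.normSq_nonneg _)).1 him k (Finset.mem_univ k)
    exact Complex.normSq_eq_zero.1 ((mul_eq_zero.1 h1).resolve_left (hs k).ne')
  have h1 := hAx i
  simp [hx0] at h1

end Positivity

/-! ### Elementary inequalities and the one-step moment estimate. -/

section Scalar

/-- A crude Young inequality. After normalization it replaces Hölder's inequality, at the cost of a
factor `2`. -/
theorem pow_sub_mul_pow_le {x y : ℝ} (hx : 0 ≤ x) (hy : 0 ≤ y) {n j : ℕ} (hj : j ≤ n) :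
    x ^ (n - j) * y ^ j ≤ x ^ n + y ^ n := by
  rcases le_total x y with h | h
  · calc x ^ (n - j) * y ^ j ≤ y ^ (n - j) * y ^ j := by gcongr
      _ = y ^ n := by rw [← pow_add, Nat.sub_add_cancel hj]
      _ ≤ _ := by linarith [pow_nonneg hx n]
  · calc x ^ (n - j) * y ^ j ≤ x ^ (n - j) * x ^ j := by gcongr
      _ = x ^ n := by rw [← pow_add, Nat.sub_add_cancel hj]
      _ ≤ _ := by linarith [pow_nonneg hy n]

theorem add_mul_le_pow {α γ c : ℝ} (hα : 0 ≤ α) (hγ : 0 ≤ γ) (hc : 1 ≤ c) {p : ℕ} (hp : 1 ≤ p) :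
    α ^ p + c * (α ^ (p - 1) * γ + γ ^ p) ≤ (α + 2 * c * γ) ^ p := by
  obtain ⟨n, rfl⟩ : ∃ n, p = n + 1 := ⟨p - 1, by omega⟩
  simp only [Nat.add_sub_cancel]
  have h1 : α ^ n ≤ (α + 2 * c * γ) ^ n := pow_le_pow_left₀ hα (by nlinarith) n
  have h2 : γ ^ n ≤ (α + 2 * c * γ) ^ n := pow_le_pow_left₀ hγ (by nlinarith) n
  have h3 : 0 ≤ c * γ := by positivity
  calc α ^ (n + 1) + c * (α ^ n * γ + γ ^ (n + 1))
      = α * α ^ n + c * γ * (α ^ n + γ ^ n) := by ring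
    _ ≤ α * (α + 2 * c * γ) ^ n
        + c * γ * ((α + 2 * c * γ) ^ n + (α + 2 * c * γ) ^ n) := by gcongr
    _ = _ := by ring

end Scalar

section Moments

variable {Ω : Type*} [MeasurableSpace Ω] {P : Measure Ω}

/-- The random variable `X` has finite absolute moments of all orders. -/
structure HasMoments (P : Measure Ω) (X : Ω → ℝ) : Prop where
  measurable : Measurable X
  integrable : ∀ q : ℕ, Integrable (fun ω => |X ω| ^ q) P

variable {X Y F G : Ω → ℝ}

theorem HasMoments.const [IsFiniteMeasure P] (c : ℝ) : HasMoments P fun _ => c :=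
  ⟨measurable_const, fun _ => integrable_const _⟩

theorem HasMoments.mul (hX : HasMoments P X) (hY : HasMoments P Y) :
    HasMoments P fun ω => X ω * Y ω := by
  refine ⟨hX.measurable.mul hY.measurable, fun q => ?_⟩
  refine ((hX.integrable (2 * q)).add (hY.integrable (2 * q))).mono' ?_ (ae_of_all _ fun ω => ?_)
  · have := hX.measurable
    have := hY.measurable
    fun_prop
  · rw [Real.norm_of_nonneg (by positivity), abs_mul, mul_pow, Pi.add_apply]
    have := pow_sub_mul_pow_le (abs_nonneg (X ω)) (abs_nonneg (Y ω)) (n := 2 * q) (j := q)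
      (by omega)
    rwa [show 2 * q - q = q by omega] at this

theorem HasMoments.add (hX : HasMoments P X) (hY : HasMoments P Y) :
    HasMoments P fun ω => X ω + Y ω := by
  refine ⟨hX.measurable.add hY.measurable, fun q => ?_⟩
  refine (((hX.integrable q).add (hY.integrable q)).const_mul (2 ^ (q - 1))).mono' ?_
    (ae_of_all _ fun ω => ?_)
  · have := hX.measurable
    have := hY.measurable
    fun_prop
  · rw [Real.norm_of_nonneg (by positivity), Pi.add_apply]
    refine le_trans ?_ (add_pow_le (abs_nonneg (X ω)) (abs_nonneg (Y ω)) q)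
    gcongr
    exact abs_add_le _ _

theorem HasMoments.sum [IsFiniteMeasure P] {ι : Type*} {s : Finset ι} {X : ι → Ω → ℝ}
    (hX : ∀ i ∈ s, HasMoments P (X i)) : HasMoments P fun ω => ∑ i ∈ s, X i ω := by
  classical
  induction s using Finset.induction_on with
  | empty => simpa using HasMoments.const 0
  | insert a s ha ih =>
    simp only [Finset.sum_insert ha]
    exact (hX a (Finset.mem_insert_self a s)).add
      (ih fun i hi => hX i (Finset.mem_insert_of_mem hi))

theorem HasMoments.pow (hX : HasMoments P X) (n : ℕ) : HasMoments P fun ω => X ω ^ n := by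
  refine ⟨hX.measurable.pow_const n, fun q => ?_⟩
  simp only [abs_pow, ← pow_mul]
  exact hX.integrable _

theorem HasMoments.integrable_self (hX : HasMoments P X) : Integrable X P := by
  have h := hX.integrable 1
  simp only [pow_one] at h
  exact (integrable_norm_iff hX.measurable.aestronglyMeasurable).1 h

/-- The constant of the moment estimates. -/
def momentConst (K : ℝ) (p : ℕ) : ℝ := 2 * (2 * K * 4 ^ p)

theorem integral_mul_pow_le {p j : ℕ} (hj : j ≤ 2 * p) {a b : ℝ} (ha : 0 < a) (hb : 0 < b)
    (hF : HasMoments P F) (hG : HasMoments P G) (hFa : ∫ ω, F ω ^ (2 * p) ∂P ≤ a ^ (2 * p))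
    (hGb : ∫ ω, G ω ^ (2 * p) ∂P ≤ b ^ (2 * p)) :
    |∫ ω, F ω ^ (2 * p - j) * G ω ^ j ∂P| ≤ 2 * (a ^ (2 * p - j) * b ^ j) := by
  have hpt : ∀ ω, |F ω ^ (2 * p - j) * G ω ^ j| ≤ a ^ (2 * p - j) * b ^ j *
      (F ω ^ (2 * p) / a ^ (2 * p) + G ω ^ (2 * p) / b ^ (2 * p)) := by
    intro ω
    have h := pow_sub_mul_pow_le (x := |F ω| / a) (y := |G ω| / b) (by positivity)
      (by positivity) hj
    have e1 : |F ω ^ (2 * p - j) * G ω ^ j|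
        = a ^ (2 * p - j) * b ^ j * ((|F ω| / a) ^ (2 * p - j) * (|G ω| / b) ^ j) := by
      rw [abs_mul, abs_pow, abs_pow, div_pow, div_pow]
      field_simp
    rw [e1]
    gcongr
    refine h.trans_eq ?_
    rw [div_pow, div_pow, Even.pow_abs ⟨p, by ring⟩, Even.pow_abs ⟨p, by ring⟩]
  have hi1 := (hF.pow (2 * p)).integrable_self
  have hi2 := (hG.pow (2 * p)).integrable_self
  calc _ ≤ ∫ ω, |F ω ^ (2 * p - j) * G ω ^ j| ∂P := abs_integral_le_integral_abs
    _ ≤ ∫ ω, a ^ (2 * p - j) * b ^ j *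
      (F ω ^ (2 * p) / a ^ (2 * p) + G ω ^ (2 * p) / b ^ (2 * p)) ∂P :=
        integral_mono ((hF.pow _).mul (hG.pow _)).integrable_self.abs
          (((hi1.div_const _).add (hi2.div_const _)).const_mul _) hpt
    _ = a ^ (2 * p - j) * b ^ j * ((∫ ω, F ω ^ (2 * p) ∂P) / a ^ (2 * p)
        + (∫ ω, G ω ^ (2 * p) ∂P) / b ^ (2 * p)) := by
        rw [integral_const_mul, integral_add (hi1.div_const _) (hi2.div_const _),
          integral_div, integral_div]
    _ ≤ a ^ (2 * p - j) * b ^ j * (1 + 1) := by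
        gcongr
        · exact (div_le_one (by positivity)).2 hFa
        · exact (div_le_one (by positivity)).2 hGb
    _ = _ := by ring

variable [IsProbabilityMeasure P]

/-- In the binomial expansion the term `j = 0` is the moment of `F`, and `j = 1` vanishes because
`X` is centered and independent of `(F, G)`. Every term with `j ≥ 2` carries a factor `σ² b²`. Hence
the constant multiplies only the increment and does not accumulate under iteration. -/
theorem moment_step_pos {p : ℕ} (hp : 1 ≤ p) {K σ a b : ℝ} (hK : 1 ≤ K) (hσ : 0 ≤ σ)
    (ha : 0 < a) (hb : 0 < b) (hX : HasMoments P X) (hF : HasMoments P F) (hG : HasMoments P G)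
    (hind : IndepFun X (fun ω => (F ω, G ω)) P) (hX0 : ∫ ω, X ω ∂P = 0)
    (hXm : ∀ j ≤ 2 * p, ∫ ω, |X ω| ^ j ∂P ≤ K * σ ^ j)
    (hFa : ∫ ω, F ω ^ (2 * p) ∂P ≤ a ^ (2 * p)) (hGb : ∫ ω, G ω ^ (2 * p) ∂P ≤ b ^ (2 * p)) :
    ∫ ω, (F ω + X ω * G ω) ^ (2 * p) ∂P
      ≤ (a ^ 2 + momentConst K p * σ ^ 2 * b ^ 2) ^ p := by
  have hexp : ∀ ω, (F ω + X ω * G ω) ^ (2 * p) = ∑ j ∈ Finset.range (2 * p + 1),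
      (X ω ^ j * (F ω ^ (2 * p - j) * G ω ^ j)) * ((2 * p).choose j : ℝ) := by
    intro ω
    rw [add_comm, add_pow]
    exact Finset.sum_congr rfl fun j _ => by rw [mul_pow]; ring
  have hint : ∀ j, ∫ ω, X ω ^ j * (F ω ^ (2 * p - j) * G ω ^ j) ∂P
      = (∫ ω, X ω ^ j ∂P) * ∫ ω, F ω ^ (2 * p - j) * G ω ^ j ∂P := by
    intro j
    have h := hind.comp (φ := fun x : ℝ => x ^ j)
      (ψ := fun y : ℝ × ℝ => y.1 ^ (2 * p - j) * y.2 ^ j) (by fun_prop) (by fun_prop)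
    exact h.integral_fun_mul_eq_mul_integral
      (hX.pow j).measurable.aestronglyMeasurable
      ((hF.pow _).mul (hG.pow _)).measurable.aestronglyMeasurable
  set γ := σ ^ 2 * b ^ 2 with hγ
  have hγ0 : 0 ≤ γ := by positivity
  have hterm : ∀ j ∈ Finset.range (2 * p + 1),
      (∫ ω, X ω ^ j * (F ω ^ (2 * p - j) * G ω ^ j) ∂P) * ((2 * p).choose j : ℝ)
      ≤ (if j = 0 then (a ^ 2) ^ p else 0)
        + (2 * K * ((a ^ 2) ^ (p - 1) * γ + γ ^ p)) * ((2 * p).choose j : ℝ) := by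
    intro j hj
    have hj' : j ≤ 2 * p := by simpa [Nat.lt_succ_iff] using hj
    rw [hint]
    have hpos : 0 ≤ (2 * K * ((a ^ 2) ^ (p - 1) * γ + γ ^ p)) * ((2 * p).choose j : ℝ) := by
      positivity
    rcases j with _ | _ | j
    · simp only [pow_zero, integral_const, probReal_univ, smul_eq_mul, mul_one, one_mul,
        Nat.sub_zero, Nat.choose_zero_right, Nat.cast_one, if_true] at hpos ⊢
      rw [← pow_mul]
      linarith
    · simp only [zero_add, pow_one, hX0, zero_mul] at hpos ⊢
      simpa using hpos
    · rw [if_neg (by omega), zero_add]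
      refine mul_le_mul_of_nonneg_right ?_ (Nat.cast_nonneg _)
      have h1 := integral_mul_pow_le hj' ha hb hF hG hFa hGb
      have h2 : |∫ ω, X ω ^ (j + 1 + 1) ∂P| ≤ K * σ ^ (j + 1 + 1) := by
        refine (abs_integral_le_integral_abs).trans ?_
        simp only [abs_pow]
        exact hXm _ hj'
      have h3 := pow_sub_mul_pow_le ha.le (mul_nonneg hσ hb.le) (n := 2 * p - 2) (j := j)
        (by omega)
      calc _ ≤ |∫ ω, X ω ^ (j + 1 + 1) ∂P|
            * |∫ ω, F ω ^ (2 * p - (j + 1 + 1)) * G ω ^ (j + 1 + 1) ∂P| := by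
            rw [← abs_mul]; exact le_abs_self _
        _ ≤ (K * σ ^ (j + 1 + 1)) * (2 * (a ^ (2 * p - (j + 1 + 1)) * b ^ (j + 1 + 1))) := by
            gcongr
        _ = 2 * K * (γ * (a ^ (2 * p - 2 - j) * (σ * b) ^ j)) := by
            rw [show 2 * p - (j + 1 + 1) = 2 * p - 2 - j by omega, hγ]
            ring
        _ ≤ 2 * K * (γ * (a ^ (2 * p - 2) + (σ * b) ^ (2 * p - 2))) := by gcongr
        _ = _ := by
            obtain ⟨n, rfl⟩ : ∃ n, p = n + 1 := ⟨p - 1, by omega⟩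
            rw [show 2 * (n + 1) - 2 = 2 * n by omega, hγ, Nat.add_sub_cancel]
            ring
  calc _ = ∑ j ∈ Finset.range (2 * p + 1),
        (∫ ω, X ω ^ j * (F ω ^ (2 * p - j) * G ω ^ j) ∂P) * ((2 * p).choose j : ℝ) := by
        simp_rw [hexp]
        rw [integral_finsetSum]
        · simp_rw [integral_mul_const]
        · intro j _
          exact ((hX.pow j).mul ((hF.pow _).mul (hG.pow _))).integrable_self.mul_const _
    _ ≤ _ := Finset.sum_le_sum hterm
    _ = (a ^ 2) ^ p + (2 * K * 4 ^ p) * ((a ^ 2) ^ (p - 1) * γ + γ ^ p) := by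
        rw [Finset.sum_add_distrib, Finset.sum_ite_eq', if_pos (by simp), ← Finset.mul_sum]
        have : ∑ j ∈ Finset.range (2 * p + 1), ((2 * p).choose j : ℝ) = 4 ^ p := by
          rw [← Nat.cast_sum, Nat.sum_range_choose, pow_mul]
          norm_num
        rw [this]
        ring
    _ ≤ _ := by
        refine (add_mul_le_pow (by positivity) hγ0 ?_ hp).trans_eq ?_
        · have : (1 : ℝ) ≤ 4 ^ p := one_le_pow₀ (by norm_num)
          nlinarith
        · rw [hγ, momentConst]
          ring

/-- Adding a centered increment `X G`, with `X` independent of `(F, G)`, increases the norm in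
`L ^ (2 p)` in a Pythagorean way. -/
theorem moment_step {p : ℕ} (hp : 1 ≤ p) {K σ α β : ℝ} (hK : 1 ≤ K) (hσ : 0 ≤ σ)
    (hα : 0 ≤ α) (hβ : 0 ≤ β) (hX : HasMoments P X) (hF : HasMoments P F) (hG : HasMoments P G)
    (hind : IndepFun X (fun ω => (F ω, G ω)) P) (hX0 : ∫ ω, X ω ∂P = 0)
    (hXm : ∀ j ≤ 2 * p, ∫ ω, |X ω| ^ j ∂P ≤ K * σ ^ j)
    (hFa : ∫ ω, F ω ^ (2 * p) ∂P ≤ α ^ p) (hGb : ∫ ω, G ω ^ (2 * p) ∂P ≤ β ^ p) :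
    ∫ ω, (F ω + X ω * G ω) ^ (2 * p) ∂P ≤ (α + momentConst K p * σ ^ 2 * β) ^ p := by
  -- The strict version divides by `a` and `b`; the degenerate cases `α = 0` and `β = 0` follow by
  -- letting `ε` tend to `0`.
  have hlim : Tendsto (fun ε : ℝ => ((α + ε) + momentConst K p * σ ^ 2 * (β + ε)) ^ p) (𝓝[>] 0)
      (𝓝 ((α + momentConst K p * σ ^ 2 * β) ^ p)) := by
    have hc : Continuous fun ε : ℝ => ((α + ε) + momentConst K p * σ ^ 2 * (β + ε)) ^ p := by
      fun_prop
    have := hc.tendsto 0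
    simp only [add_zero] at this
    exact this.mono_left nhdsWithin_le_nhds
  refine ge_of_tendsto hlim ?_
  filter_upwards [self_mem_nhdsWithin] with ε hε
  have hε' : (0 : ℝ) < ε := hε
  have hs : ∀ x : ℝ, 0 ≤ x → √x ^ 2 = x := fun x hx => Real.sq_sqrt hx
  have h := moment_step_pos hp hK hσ (Real.sqrt_pos.2 (show 0 < α + ε by linarith))
    (Real.sqrt_pos.2 (show 0 < β + ε by linarith)) hX hF hG hind hX0 hXm ?_ ?_
  · rwa [hs _ (by linarith), hs _ (by linarith)] at h
  · rw [pow_mul, hs _ (by linarith)]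
    refine hFa.trans ?_
    gcongr
    linarith
  · rw [pow_mul, hs _ (by linarith)]
    refine hGb.trans ?_
    gcongr
    linarith

end Moments

theorem momentConst_nonneg {K : ℝ} (hK : 1 ≤ K) (p : ℕ) : 0 ≤ momentConst K p := by
  unfold momentConst
  positivity

/-! ### Moments of linear and off-diagonal quadratic forms. -/

section Families

variable {Ω : Type*} [MeasurableSpace Ω] {P : Measure Ω} {ι : Type*}

/-- Independent centered variables `Y i` whose absolute moments up to order `2 p` are at most
`K σ_i ^ j`. -/
structure IsCenteredFamily (P : Measure Ω) (p : ℕ) (K : ℝ) (σ : ι → ℝ) (Y : ι → Ω → ℝ) :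
    Prop where
  hasMoments : ∀ i, HasMoments P (Y i)
  indep : iIndepFun Y P
  mean_zero : ∀ i, ∫ ω, Y i ω ∂P = 0
  moments : ∀ i, ∀ j ≤ 2 * p, ∫ ω, |Y i ω| ^ j ∂P ≤ K * σ i ^ j
  sigma_nonneg : ∀ i, 0 ≤ σ i

variable [DecidableEq ι] {p : ℕ} {K : ℝ} {σ : ι → ℝ} {Y : ι → Ω → ℝ}

/-- Setting the coordinates off `s` to zero allows any measurable function of the full vector to be
composed, without subtypes. -/
theorem indepFun_truncate (hmeas : ∀ i, Measurable (Y i)) (hY : iIndepFun Y P) {s : Finset ι}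
    {n : ι} (hn : n ∉ s) :
    IndepFun (Y n) (fun ω k => if k ∈ s then Y k ω else 0) P := by
  have h := hY.indepFun_finset {n} s (by simpa using hn) hmeas
  have hm : Measurable fun v : (({n} : Finset ι) → ℝ) => v ⟨n, by simp⟩ :=
    measurable_pi_apply _
  have h2 := h.comp (φ := fun v : (({n} : Finset ι) → ℝ) => v ⟨n, by simp⟩)
    (ψ := fun (v : s → ℝ) (k : ι) => if hk : k ∈ s then v ⟨k, hk⟩ else 0)
    hm
    (measurable_pi_lambda _ fun k => by
      by_cases hk : k ∈ s
      · simp only [hk, dif_pos]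
        exact measurable_pi_apply _
      · simp only [hk, dif_neg, not_false_eq_true]
        exact measurable_const)
  change IndepFun (Y n) _ P at h2
  convert h2 using 1
  ext ω k
  by_cases hk : k ∈ s <;> simp [hk]

variable [IsProbabilityMeasure P]

theorem IsCenteredFamily.linear_moment (hY : IsCenteredFamily P p K σ Y) (hp : 1 ≤ p)
    (hK : 1 ≤ K) (a : ι → ℝ) (s : Finset ι) :
    ∫ ω, (∑ k ∈ s, Y k ω * a k) ^ (2 * p) ∂P
      ≤ (momentConst K p * ∑ k ∈ s, σ k ^ 2 * a k ^ 2) ^ p := by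
  induction s using Finset.induction_on with
  | empty => simp [show p ≠ 0 by omega]
  | insert n s hn ih =>
    have hC := momentConst_nonneg hK p
    have hind : IndepFun (Y n) (fun ω => (∑ k ∈ s, Y k ω * a k, a n)) P := by
      have h := (indepFun_truncate (fun i => (hY.hasMoments i).measurable) hY.indep hn).comp
        (φ := id) (ψ := fun v : ι → ℝ => (∑ k ∈ s, v k * a k, a n)) measurable_id (by fun_prop)
      change IndepFun (Y n) _ P at h
      convert h using 1
      ext ω
      · simp only [Function.comp_apply]
        exact Finset.sum_congr rfl fun k hk => by rw [if_pos hk]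
      · rfl
    have h := moment_step hp hK (hY.sigma_nonneg n)
      (mul_nonneg hC (Finset.sum_nonneg fun k _ => by positivity)) (sq_nonneg (a n))
      (hY.hasMoments n) (HasMoments.sum fun k _ => (hY.hasMoments k).mul (HasMoments.const (a k)))
      (HasMoments.const (a n)) hind (hY.mean_zero n) (hY.moments n) ih
      (by simp [← pow_mul])
    simp only [Finset.sum_insert hn]
    refine (le_of_eq ?_).trans (h.trans_eq ?_)
    · congr 1
      ext ω
      ring
    · ring

theorem sum_insert_erase {M : Type*} [AddCommMonoid M] {s : Finset ι} {n : ι} (hn : n ∉ s)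
    (h : ι → ι → M) :
    ∑ k ∈ insert n s, ∑ l ∈ (insert n s).erase k, h k l
      = ∑ k ∈ s, ∑ l ∈ s.erase k, h k l + ∑ k ∈ s, (h n k + h k n) := by
  rw [Finset.sum_insert hn, Finset.erase_insert hn, Finset.sum_add_distrib]
  have : ∀ k ∈ s, ∑ l ∈ (insert n s).erase k, h k l = h k n + ∑ l ∈ s.erase k, h k l := by
    intro k hk
    have hkn : n ≠ k := fun e => hn (e ▸ hk)
    rw [Finset.erase_insert_of_ne hkn, Finset.sum_insert fun e => hn (Finset.mem_of_mem_erase e)]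
  rw [Finset.sum_congr rfl this, Finset.sum_add_distrib]
  abel

/-- Adding the index `n` adds `Y n` times the linear form with coefficients `a n k + a k n`. One
factor of the constant comes from this step, another from `linear_moment`, and the `2` from `(a +
b)² ≤ 2 (a² + b²)`. -/
theorem IsCenteredFamily.quadratic_moment (hY : IsCenteredFamily P p K σ Y) (hp : 1 ≤ p)
    (hK : 1 ≤ K) (a : ι → ι → ℝ) (s : Finset ι) :
    ∫ ω, (∑ k ∈ s, ∑ l ∈ s.erase k, Y k ω * Y l ω * a k l) ^ (2 * p) ∂P
      ≤ (2 * momentConst K p ^ 2 * ∑ k ∈ s, ∑ l ∈ s.erase k,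
        σ k ^ 2 * σ l ^ 2 * a k l ^ 2) ^ p := by
  induction s using Finset.induction_on with
  | empty => simp [show p ≠ 0 by omega]
  | insert n s hn ih =>
    have hC := momentConst_nonneg hK p
    have hind : IndepFun (Y n) (fun ω => (∑ k ∈ s, ∑ l ∈ s.erase k, Y k ω * Y l ω * a k l,
        ∑ k ∈ s, Y k ω * (a n k + a k n))) P := by
      have h := (indepFun_truncate (fun i => (hY.hasMoments i).measurable) hY.indep hn).comp
        (φ := id) (ψ := fun v : ι → ℝ => (∑ k ∈ s, ∑ l ∈ s.erase k, v k * v l * a k l,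
          ∑ k ∈ s, v k * (a n k + a k n))) measurable_id (by fun_prop)
      change IndepFun (Y n) _ P at h
      convert h using 1
      ext ω
      · simp only [Function.comp_apply]
        exact Finset.sum_congr rfl fun k hk => Finset.sum_congr rfl fun l hl => by
          rw [if_pos hk, if_pos (Finset.mem_of_mem_erase hl)]
      · simp only [Function.comp_apply]
        exact Finset.sum_congr rfl fun k hk => by rw [if_pos hk]
    have h := moment_step hp hK (hY.sigma_nonneg n)
      (mul_nonneg (mul_nonneg zero_le_two (sq_nonneg (momentConst K p)))
        (Finset.sum_nonneg fun k _ => Finset.sum_nonneg fun l _ => by positivity))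
      (mul_nonneg hC (Finset.sum_nonneg fun k _ => by positivity))
      (hY.hasMoments n)
      (HasMoments.sum fun k _ => HasMoments.sum fun l _ =>
        ((hY.hasMoments k).mul (hY.hasMoments l)).mul (HasMoments.const (a k l)))
      (HasMoments.sum fun k _ => (hY.hasMoments k).mul (HasMoments.const (a n k + a k n)))
      hind (hY.mean_zero n) (hY.moments n) ih (hY.linear_moment hp hK (fun k => a n k + a k n) s)
    simp only [sum_insert_erase hn]
    calc _ = ∫ ω, (∑ k ∈ s, ∑ l ∈ s.erase k, Y k ω * Y l ω * a k l
          + Y n ω * ∑ k ∈ s, Y k ω * (a n k + a k n)) ^ (2 * p) ∂P := by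
          congr 1
          ext ω
          congr 2
          rw [Finset.mul_sum]
          exact Finset.sum_congr rfl fun k _ => by ring
      _ ≤ _ := h
      _ ≤ _ := by
          have hnn : 0 ≤ ∑ k ∈ s, ∑ l ∈ s.erase k, σ k ^ 2 * σ l ^ 2 * a k l ^ 2 :=
            Finset.sum_nonneg fun k _ => Finset.sum_nonneg fun l _ => by positivity
          have hnn2 : 0 ≤ ∑ k ∈ s, σ k ^ 2 * (a n k + a k n) ^ 2 :=
            Finset.sum_nonneg fun k _ => by positivity
          refine pow_le_pow_left₀ (by positivity) ?_ p
          rw [mul_add]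
          refine (add_le_add_iff_left _).2 ?_
          calc _ = momentConst K p ^ 2 * ∑ k ∈ s, σ n ^ 2 * (σ k ^ 2 * (a n k + a k n) ^ 2) := by
                rw [← Finset.mul_sum]; ring
            _ ≤ momentConst K p ^ 2 * ∑ k ∈ s, 2 * (σ n ^ 2 * σ k ^ 2 * a n k ^ 2
                  + σ k ^ 2 * σ n ^ 2 * a k n ^ 2) := by
                refine mul_le_mul_of_nonneg_left (Finset.sum_le_sum fun k _ => ?_) (sq_nonneg _)
                have : (a n k + a k n) ^ 2 ≤ 2 * (a n k ^ 2 + a k n ^ 2) := by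
                  nlinarith [sq_nonneg (a n k - a k n)]
                calc _ ≤ σ n ^ 2 * (σ k ^ 2 * (2 * (a n k ^ 2 + a k n ^ 2))) := by gcongr
                  _ = _ := by ring
            _ = _ := by
                rw [← Finset.mul_sum]; ring

end Families

/-! ### Self-normalized tail bounds. -/

section Tail

variable {Ω : Type*} [MeasurableSpace Ω] {P : Measure Ω} [IsProbabilityMeasure P]

/-- Markov's inequality for the power `2 p`. The strict inequality in the event lets `V = 0` be
included, where `X = 0` almost surely; this matters because `V` will be a conditional variance
without a lower bound. -/
theorem tail_le_of_moment {X : Ω → ℝ} {p : ℕ} (hp : 1 ≤ p) (hX : HasMoments P X) {C V θ : ℝ}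
    (hC : 0 ≤ C) (hV : 0 ≤ V) (hθ : 0 < θ) (h : ∫ ω, X ω ^ (2 * p) ∂P ≤ (C * V) ^ p) :
    P.real {ω | θ ^ 2 * V < X ω ^ 2} ≤ C ^ p / θ ^ (2 * p) := by
  have hint := (hX.pow (2 * p)).integrable_self
  have hnn : ∀ ω, 0 ≤ X ω ^ (2 * p) := fun ω => by rw [pow_mul]; positivity
  rcases hV.eq_or_lt with rfl | hV
  · rw [mul_zero, zero_pow (by omega)] at h
    have h0 : ∫ ω, X ω ^ (2 * p) ∂P = 0 := le_antisymm h (integral_nonneg hnn)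
    have h1 := (integral_eq_zero_iff_of_nonneg hnn hint).1 h0
    have h2 : P {ω | θ ^ 2 * 0 < X ω ^ 2} = 0 := by
      refine measure_mono_null (fun ω hω => ?_) (ae_iff.1 h1)
      intro h3
      simp only [mul_zero, Set.mem_ofPred_eq] at hω
      have h4 : X ω = 0 := (pow_eq_zero_iff (n := 2 * p) (by omega)).1 h3
      rw [h4] at hω
      simp at hω
    rw [Measure.real, h2]
    simp only [ENNReal.toReal_zero]
    positivity
  · have h1 := mul_meas_ge_le_integral_of_nonneg (ae_of_all P hnn) hint ((θ ^ 2 * V) ^ p)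
    have h2 : P.real {ω | θ ^ 2 * V < X ω ^ 2} ≤ P.real {ω | (θ ^ 2 * V) ^ p ≤ X ω ^ (2 * p)} := by
      refine measureReal_mono fun ω hω => ?_
      simp only [Set.mem_ofPred_eq] at hω ⊢
      rw [pow_mul]
      gcongr
    have h3 : (θ ^ 2 * V) ^ p * P.real {ω | θ ^ 2 * V < X ω ^ 2} ≤ (C * V) ^ p :=
      (mul_le_mul_of_nonneg_left h2 (by positivity)).trans (h1.trans h)
    rw [le_div_iff₀ (by positivity)]
    have h4 : 0 < V ^ p := by positivity
    rw [mul_pow, mul_pow, ← pow_mul] at h3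
    refine le_of_mul_le_mul_right ?_ h4
    linarith

theorem tail_complex_le {X₁ X₂ : Ω → ℝ} {Z : Ω → ℂ} {p : ℕ} (hp : 1 ≤ p)
    (hX₁ : HasMoments P X₁) (hX₂ : HasMoments P X₂) (hZ : ∀ ω, Z ω = X₁ ω + X₂ ω * Complex.I)
    {C V₁ V₂ V θ : ℝ} (hC : 0 ≤ C) (hV₁ : 0 ≤ V₁) (hV₂ : 0 ≤ V₂) (hV : V = V₁ + V₂) (hθ : 0 < θ)
    (h₁ : ∫ ω, X₁ ω ^ (2 * p) ∂P ≤ (C * V₁) ^ p) (h₂ : ∫ ω, X₂ ω ^ (2 * p) ∂P ≤ (C * V₂) ^ p) :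
    P.real {ω | θ ^ 2 * V < ‖Z ω‖ ^ 2} ≤ 2 * (C ^ p / θ ^ (2 * p)) := by
  have hsub : {ω | θ ^ 2 * V < ‖Z ω‖ ^ 2}
      ⊆ {ω | θ ^ 2 * V₁ < X₁ ω ^ 2} ∪ {ω | θ ^ 2 * V₂ < X₂ ω ^ 2} := by
    intro ω hω
    by_contra hcon
    simp only [Set.mem_union, Set.mem_ofPred_eq, not_or, not_lt] at hω hcon
    rw [hZ, ← Complex.normSq_eq_norm_sq, Complex.normSq_add_mul_I, hV, mul_add] at hω
    linarith [hcon.1, hcon.2]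
  refine (measureReal_mono hsub).trans ((measureReal_union_le _ _).trans ?_)
  linarith [tail_le_of_moment hp hX₁ hC hV₁ hθ h₁, tail_le_of_moment hp hX₂ hC hV₂ hθ h₂]

variable {ι : Type*} [DecidableEq ι] {p : ℕ} {K : ℝ} {σ : ι → ℝ} {Y : ι → Ω → ℝ} {θ : ℝ}

theorem norm_sq_eq_re_im (z : ℂ) : ‖z‖ ^ 2 = z.re ^ 2 + z.im ^ 2 := by
  rw [← Complex.normSq_eq_norm_sq, Complex.normSq_apply]
  ring

theorem IsCenteredFamily.linear_tail (hY : IsCenteredFamily P p K σ Y) (hp : 1 ≤ p)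
    (hK : 1 ≤ K) (hθ : 0 < θ) (a : ι → ℂ) (s : Finset ι) :
    P.real {ω | θ ^ 2 * ∑ k ∈ s, σ k ^ 2 * ‖a k‖ ^ 2 < ‖∑ k ∈ s, (Y k ω : ℂ) * a k‖ ^ 2}
      ≤ 2 * (momentConst K p ^ p / θ ^ (2 * p)) := by
  refine tail_complex_le hp
    (HasMoments.sum fun k _ => (hY.hasMoments k).mul (HasMoments.const (a k).re))
    (HasMoments.sum fun k _ => (hY.hasMoments k).mul (HasMoments.const (a k).im))
    (fun ω => ?_) (momentConst_nonneg hK p)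
    (Finset.sum_nonneg fun k _ => by positivity) (Finset.sum_nonneg fun k _ => by positivity)
    ?_ hθ
    (hY.linear_moment hp hK (fun k => (a k).re) s)
    (hY.linear_moment hp hK (fun k => (a k).im) s)
  · push_cast
    rw [Finset.sum_mul, ← Finset.sum_add_distrib]
    refine Finset.sum_congr rfl fun k _ => ?_
    conv_lhs => rw [← Complex.re_add_im (a k)]
    ring
  · rw [← Finset.sum_add_distrib]
    exact Finset.sum_congr rfl fun k _ => by rw [norm_sq_eq_re_im]; ring

theorem IsCenteredFamily.quadratic_tail (hY : IsCenteredFamily P p K σ Y) (hp : 1 ≤ p)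
    (hK : 1 ≤ K) (hθ : 0 < θ) (a : ι → ι → ℂ) (s : Finset ι) :
    P.real {ω | θ ^ 2 * ∑ k ∈ s, ∑ l ∈ s.erase k, σ k ^ 2 * σ l ^ 2 * ‖a k l‖ ^ 2
        < ‖∑ k ∈ s, ∑ l ∈ s.erase k, (Y k ω : ℂ) * Y l ω * a k l‖ ^ 2}
      ≤ 2 * ((2 * momentConst K p ^ 2) ^ p / θ ^ (2 * p)) := by
  refine tail_complex_le hp
    (HasMoments.sum fun k _ => HasMoments.sum fun l _ =>
        ((hY.hasMoments k).mul (hY.hasMoments l)).mul (HasMoments.const (a k l).re))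
    (HasMoments.sum fun k _ => HasMoments.sum fun l _ =>
        ((hY.hasMoments k).mul (hY.hasMoments l)).mul (HasMoments.const (a k l).im))
    (fun ω => ?_) (by positivity)
    (Finset.sum_nonneg fun k _ => Finset.sum_nonneg fun l _ => by positivity)
    (Finset.sum_nonneg fun k _ => Finset.sum_nonneg fun l _ => by positivity)
    ?_ hθ
    (hY.quadratic_moment hp hK (fun k l => (a k l).re) s)
    (hY.quadratic_moment hp hK (fun k l => (a k l).im) s)
  · push_cast
    simp only [Finset.sum_mul, ← Finset.sum_add_distrib]
    refine Finset.sum_congr rfl fun k _ => Finset.sum_congr rfl fun l _ => ?_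
    conv_lhs => rw [← Complex.re_add_im (a k l)]
    ring
  · simp only [← Finset.sum_add_distrib]
    exact Finset.sum_congr rfl fun k _ => Finset.sum_congr rfl fun l _ => by
      rw [norm_sq_eq_re_im]; ring

end Tail

/-! ### Moments and independence for the rows of the band ensemble. -/

section Ensemble

variable {N : ℕ} {Ω : Type*} [MeasurableSpace Ω] {P : Measure Ω}
  {S : Matrix (ZMod N) (ZMod N) ℝ} {μ : ℕ → ℝ} {H : Ω → Matrix (ZMod N) (ZMod N) ℝ}

theorem IsBandEnsemble.variance_nonneg (h : IsBandEnsemble P S μ H) (i j : ZMod N) :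
    0 ≤ S i j := by
  rw [← h.second_moment]
  exact integral_nonneg fun ω => by positivity

theorem IsBandEnsemble.hasMoments (h : IsBandEnsemble P S μ H) (i j : ZMod N) :
    HasMoments P fun ω => H ω i j := ⟨h.measurable i j, h.moments_integrable i j⟩

/-- A common bound of the normalized moments up to order `4 p`. -/
def momentBound (μ : ℕ → ℝ) (p : ℕ) : ℝ := 1 + ∑ j ∈ Finset.range (4 * p + 1), |μ j| ^ j

theorem one_le_momentBound (μ : ℕ → ℝ) (p : ℕ) : 1 ≤ momentBound μ p :=
  le_add_of_nonneg_right (Finset.sum_nonneg fun j _ => by positivity)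

theorem IsBandEnsemble.moment_le [IsProbabilityMeasure P] (h : IsBandEnsemble P S μ H)
    (i j : ZMod N) {p q : ℕ}
    (hq : q ≤ 4 * p) : ∫ ω, |H ω i j| ^ q ∂P ≤ momentBound μ p * √(S i j) ^ q := by
  rcases Nat.eq_zero_or_pos q with rfl | hq0
  · simpa using one_le_momentBound μ p
  · have hvar : variance (fun ω => H ω i j) P = S i j := by
      rw [variance_of_integral_eq_zero (h.measurable i j).aemeasurable (h.mean_zero i j),
        ← h.second_moment i j]
      simp only [sq_abs]
    have h1 := h.moments i j q hq0
    rw [hvar, one_div] at h1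
    have hnn : 0 ≤ ∫ ω, |H ω i j| ^ q ∂P := integral_nonneg fun ω => by positivity
    have h2 := pow_le_pow_left₀ (Real.rpow_nonneg hnn _) h1 q
    rw [Real.rpow_inv_natCast_pow hnn (by omega), mul_pow] at h2
    refine h2.trans (mul_le_mul_of_nonneg_right ?_ (by positivity))
    have h3 : |μ q| ^ q ≤ ∑ j ∈ Finset.range (4 * p + 1), |μ j| ^ j :=
      Finset.single_le_sum (f := fun j => |μ j| ^ j) (fun j _ => by positivity)
        (Finset.mem_range.2 (by omega))
    have h4 : μ q ^ q ≤ |μ q| ^ q := by rw [← abs_pow]; exact le_abs_self _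
    unfold momentBound
    linarith

/-- The representative `{i, j}` with ordered entries. -/
def sortedPair (i j : ZMod N) : {p : ZMod N × ZMod N // p.1.val ≤ p.2.val} :=
  if h : i.val ≤ j.val then ⟨(i, j), h⟩ else ⟨(j, i), (not_le.1 h).le⟩

theorem sortedPair_cases (i j : ZMod N) :
    (sortedPair i j).1 = (i, j) ∨ (sortedPair i j).1 = (j, i) := by
  unfold sortedPair
  split_ifs
  · exact Or.inl rfl
  · exact Or.inr rfl

theorem sortedPair_injective (i : ZMod N) : Function.Injective (sortedPair i) := by
  intro j k hjk
  have h := congrArg Subtype.val hjk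
  rcases sortedPair_cases i j with h1 | h1 <;> rcases sortedPair_cases i k with h2 | h2 <;>
    rw [h1, h2, Prod.mk.injEq] at h
  · exact h.2
  · exact h.2.trans h.1
  · exact h.1.trans h.2
  · exact h.1

theorem IsBandEnsemble.apply_sortedPair (h : IsBandEnsemble P S μ H) (ω : Ω) (i j : ZMod N) :
    H ω (sortedPair i j).1.1 (sortedPair i j).1.2 = H ω i j := by
  rcases sortedPair_cases i j with h1 | h1 <;> rw [h1]
  exact h.symm ω j i

theorem IsBandEnsemble.iIndepFun_row (h : IsBandEnsemble P S μ H) (i : ZMod N) :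
    iIndepFun (fun k ω => H ω i k) P := by
  have h1 := h.indep.precomp (sortedPair_injective i)
  convert h1 using 1
  ext k ω
  exact (h.apply_sortedPair ω i k).symm

/-- The constant in the moment bounds for the entries and their centered squares. -/
def entryConst (μ : ℕ → ℝ) (p : ℕ) : ℝ := 4 ^ p * (momentBound μ p + 1)

theorem momentBound_le_entryConst (μ : ℕ → ℝ) (p : ℕ) : momentBound μ p ≤ entryConst μ p := by
  have h1 := one_le_momentBound μ p
  have h2 : (1 : ℝ) ≤ 4 ^ p := one_le_pow₀ (by norm_num)
  unfold entryConst
  nlinarith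

theorem one_le_entryConst (μ : ℕ → ℝ) (p : ℕ) : 1 ≤ entryConst μ p :=
  (one_le_momentBound μ p).trans (momentBound_le_entryConst μ p)

theorem IsBandEnsemble.isCenteredFamily_row [IsProbabilityMeasure P]
    (h : IsBandEnsemble P S μ H) (p : ℕ) (i : ZMod N) :
    IsCenteredFamily P p (entryConst μ p) (fun k => √(S i k)) (fun k ω => H ω i k) where
  hasMoments k := h.hasMoments i k
  indep := h.iIndepFun_row i
  mean_zero k := h.mean_zero i k
  -- The bound reaches order `4 p` because the centered squares need their own moments up to order
  -- `2 p`.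
  moments k j hj := (h.moment_le i k (p := p) (by omega)).trans
    (mul_le_mul_of_nonneg_right (momentBound_le_entryConst μ p) (by positivity))
  sigma_nonneg k := Real.sqrt_nonneg _

theorem IsBandEnsemble.isCenteredFamily_sq [IsProbabilityMeasure P]
    (h : IsBandEnsemble P S μ H) (p : ℕ) (i : ZMod N) :
    IsCenteredFamily P p (entryConst μ p) (fun k => S i k) (fun k ω => H ω i k ^ 2 - S i k) where
  hasMoments k := ((h.hasMoments i k).pow 2).add (HasMoments.const (-S i k))
  indep := (h.iIndepFun_row i).comp (fun k x => x ^ 2 - S i k) fun k => by fun_prop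
  mean_zero k := by
    rw [integral_sub ((h.hasMoments i k).pow 2).integrable_self (integrable_const _),
      integral_const, ← h.second_moment i k]
    simp
  moments k j hj := by
    have hS := h.variance_nonneg i k
    have hpt : ∀ ω, |H ω i k ^ 2 - S i k| ^ j ≤ 4 ^ p * (|H ω i k| ^ (2 * j) + S i k ^ j) := by
      intro ω
      calc |H ω i k ^ 2 - S i k| ^ j ≤ (|H ω i k| ^ 2 + S i k) ^ j := by
            gcongr
            rw [abs_le, sq_abs]
            constructor <;> linarith [sq_nonneg (H ω i k)]
        _ ≤ 2 ^ (j - 1) * ((|H ω i k| ^ 2) ^ j + S i k ^ j) := add_pow_le (by positivity) hS j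
        _ ≤ 2 ^ (2 * p) * ((|H ω i k| ^ 2) ^ j + S i k ^ j) := by
            gcongr
            · norm_num
            · omega
        _ = _ := by
            rw [pow_mul 2 2 p, ← pow_mul |H ω i k|]
            norm_num
    have hi := (h.hasMoments i k).integrable (2 * j)
    calc _ ≤ ∫ ω, 4 ^ p * (|H ω i k| ^ (2 * j) + S i k ^ j) ∂P :=
          integral_mono
            ((((h.hasMoments i k).pow 2).add (HasMoments.const (-S i k))).integrable j)
            ((hi.add (integrable_const _)).const_mul _) hpt
      _ = 4 ^ p * (∫ ω, |H ω i k| ^ (2 * j) ∂P + S i k ^ j) := by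
          rw [integral_const_mul, integral_add hi (integrable_const _)]
          simp
      _ ≤ 4 ^ p * (momentBound μ p * √(S i k) ^ (2 * j) + S i k ^ j) := by
          gcongr
          exact h.moment_le i k (by omega)
      _ = _ := by
          rw [pow_mul, Real.sq_sqrt hS, entryConst]
          ring
  sigma_nonneg k := h.variance_nonneg i k

/-- The row `i` is independent of the entries outside row and column `i`. -/
theorem IsBandEnsemble.indepFun_row_minor [NeZero N] (h : IsBandEnsemble P S μ H) (i : ZMod N) :
    IndepFun (fun ω k => H ω i k) (fun ω k l => if k = i ∨ l = i then 0 else H ω k l) P := by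
  classical
  let A : Finset {p : ZMod N × ZMod N // p.1.val ≤ p.2.val} :=
    Finset.univ.filter fun q => q.1.1 = i ∨ q.1.2 = i
  have hA : ∀ k, sortedPair i k ∈ A := fun k => by
    rcases sortedPair_cases i k with h1 | h1 <;> simp [A, h1]
  have hAc : ∀ k l, ¬(k = i ∨ l = i) → sortedPair k l ∈ Aᶜ := fun k l hkl => by
    rw [not_or] at hkl
    rcases sortedPair_cases k l with h1 | h1 <;> simp [A, h1, hkl.1, hkl.2]
  have h1 := h.indep.indepFun_finset A Aᶜ disjoint_compl_right fun q => h.measurable _ _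
  have hm1 : Measurable fun (v : A → ℝ) (k : ZMod N) => v ⟨sortedPair i k, hA k⟩ :=
    measurable_pi_lambda _ fun k => measurable_pi_apply _
  have hm2 : Measurable fun (v : (Aᶜ : Finset _) → ℝ) (k l : ZMod N) =>
      if hkl : k = i ∨ l = i then 0 else v ⟨sortedPair k l, hAc k l hkl⟩ := by
    refine measurable_pi_lambda _ fun k => measurable_pi_lambda _ fun l => ?_
    by_cases hkl : k = i ∨ l = i
    · simp only [hkl, dif_pos]
      exact measurable_const
    · simp only [hkl, dif_neg, not_false_eq_true]
      exact measurable_pi_apply _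
  have h2 := h1.comp hm1 hm2
  convert h2 using 1
  · ext ω k
    exact (h.apply_sortedPair ω i k).symm
  · ext ω k l
    by_cases hkl : k = i ∨ l = i
    · simp [hkl]
    · simp only [hkl, if_false, Function.comp_apply, dif_neg, not_false_eq_true]
      exact (h.apply_sortedPair ω k l).symm

end Ensemble

/-- Fubini: the joint law is a product, so a bound uniform over frozen values of `V` survives
integration. This is how conditioning on the minor is carried out. -/
theorem measureReal_le_of_indepFun {Ω α β : Type*} [MeasurableSpace Ω] [MeasurableSpace α]
    [MeasurableSpace β] {P : Measure Ω} [IsProbabilityMeasure P] {U : Ω → α} {V : Ω → β}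
    (hU : Measurable U) (hV : Measurable V) (hUV : IndepFun U V P) {B : Set (α × β)}
    (hB : MeasurableSet B) {c : ℝ} (hc : ∀ b, P.real {ω | (U ω, b) ∈ B} ≤ c) :
    P.real {ω | (U ω, V ω) ∈ B} ≤ c := by
  have hc0 : 0 ≤ c := by
    obtain ⟨ω⟩ : Nonempty Ω := nonempty_of_isProbabilityMeasure P
    exact measureReal_nonneg.trans (hc (V ω))
  have : IsProbabilityMeasure (P.map V) := Measure.isProbabilityMeasure_map hV.aemeasurable
  have : IsProbabilityMeasure (P.map U) := Measure.isProbabilityMeasure_map hU.aemeasurable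
  have hmap := (indepFun_iff_map_prod_eq_prod_map_map hU.aemeasurable hV.aemeasurable).1 hUV
  have h1 : P {ω | (U ω, V ω) ∈ B} = P.map (fun ω => (U ω, V ω)) B :=
    (Measure.map_apply (hU.prodMk hV) hB).symm
  have h2 : P {ω | (U ω, V ω) ∈ B} ≤ ENNReal.ofReal c := by
    rw [h1, hmap, Measure.prod_apply_symm hB]
    calc _ ≤ ∫⁻ _, ENNReal.ofReal c ∂(P.map V) := by
          refine lintegral_mono fun b => ?_
          rw [Measure.map_apply hU (measurable_prodMk_right hB)]
          have := hc b
          rw [Measure.real] at this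
          exact (ENNReal.le_ofReal_iff_toReal_le (measure_ne_top _ _) hc0).2 this
      _ = _ := by simp
  rw [Measure.real]
  exact ENNReal.toReal_le_of_le_ofReal hc0 h2

/-! ### The event on which all large deviation bounds hold. -/

section GoodEvent

/-- The large deviation bounds for the linear and quadratic forms built from the `i`-th row `h` of
the random matrix and a matrix `R` independent of it. -/
structure IsGoodRow {ι : Type*} [Fintype ι] [DecidableEq ι] (S : Matrix ι ι ℝ) (θ : ℝ) (i : ι)
    (h : ι → ℝ) (R : ι → ι → ℂ) : Prop where
  linear : ∀ j, ‖∑ k ∈ Finset.univ.erase i, (h k : ℂ) * R k j‖ ^ 2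
    ≤ θ ^ 2 * ∑ k ∈ Finset.univ.erase i, S i k * ‖R k j‖ ^ 2
  quadratic : ‖∑ k ∈ Finset.univ.erase i, ∑ l ∈ (Finset.univ.erase i).erase k,
      (h k : ℂ) * h l * R k l‖ ^ 2
    ≤ θ ^ 2 * ∑ k ∈ Finset.univ.erase i, ∑ l ∈ (Finset.univ.erase i).erase k,
      S i k * S i l * ‖R k l‖ ^ 2
  diagonal : ‖∑ k ∈ Finset.univ.erase i, ((h k ^ 2 - S i k : ℝ) : ℂ) * R k k‖ ^ 2
    ≤ θ ^ 2 * ∑ k ∈ Finset.univ.erase i, S i k ^ 2 * ‖R k k‖ ^ 2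
  entry : h i ^ 2 ≤ θ ^ 2 * S i i

variable {N : ℕ}

theorem continuous_minorMatrix_shifted (W : ℕ) (g : ZMod N → ℝ) (z w : ℂ) (i : ZMod N) :
    Continuous fun v : ZMod N → ZMod N → ℝ =>
      minorMatrix (shifted W (Matrix.of v) g z w) i := by
  refine continuous_matrix fun k l => ?_
  simp only [minorMatrix, shifted, Matrix.of_apply, Matrix.sub_apply, Matrix.map_apply]
  split_ifs <;> fun_prop

theorem minorMatrix_shifted_congr (W : ℕ) (H : Matrix (ZMod N) (ZMod N) ℝ) (g : ZMod N → ℝ)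
    (z w : ℂ) (i : ZMod N) :
    minorMatrix (shifted W (Matrix.of fun k l => if k = i ∨ l = i then 0 else H k l) g z w) i
      = minorMatrix (shifted W H g z w) i := by
  ext k l
  simp only [minorMatrix, shifted, Matrix.of_apply, Matrix.sub_apply, Matrix.map_apply]
  split_ifs <;> rfl

variable [NeZero N]

/-- The inverse is the inverse determinant times the adjugate, with value zero on singular matrices;
measurability therefore holds everywhere, even where the resolvent does not exist. -/
theorem measurable_inv_minorMatrix (W : ℕ) (g : ZMod N → ℝ) (z w : ℂ) (i : ZMod N) :
    Measurable fun (v : ZMod N → ZMod N → ℝ) (k l : ZMod N) =>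
      (minorMatrix (shifted W (Matrix.of v) g z w) i)⁻¹ k l := by
  have hc := continuous_minorMatrix_shifted W g z w i
  refine measurable_pi_lambda _ fun k => measurable_pi_lambda _ fun l => ?_
  simp only [Matrix.inv_def, Ring.inverse_eq_inv', Matrix.smul_apply, smul_eq_mul]
  exact hc.matrix_det.measurable.inv.mul (hc.matrix_adjugate.matrix_elem k l).measurable

variable {Ω : Type*} [MeasurableSpace Ω] {P : Measure Ω} [IsProbabilityMeasure P]
  {S : Matrix (ZMod N) (ZMod N) ℝ} {μ : ℕ → ℝ} {H : Ω → Matrix (ZMod N) (ZMod N) ℝ}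

/-- A bound for deterministic `R` carries over to the inverse minor. -/
theorem IsBandEnsemble.measureReal_minor_le (h : IsBandEnsemble P S μ H) (W : ℕ)
    (g : ZMod N → ℝ) (z w : ℂ) (i : ZMod N)
    {B : Set ((ZMod N → ℝ) × (ZMod N → ZMod N → ℂ))} (hB : MeasurableSet B) {c : ℝ}
    (hc : ∀ b, P.real {ω | (fun k => H ω i k, b) ∈ B} ≤ c) :
    P.real {ω | (fun k => H ω i k,
      fun k l => (minorMatrix (shifted W (H ω) g z w) i)⁻¹ k l) ∈ B} ≤ c := by
  have hm := measurable_inv_minorMatrix W g z w i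
  have hV : Measurable fun ω (k l : ZMod N) => if k = i ∨ l = i then 0 else H ω k l := by
    refine measurable_pi_lambda _ fun k => measurable_pi_lambda _ fun l => ?_
    split_ifs
    · exact measurable_const
    · exact h.measurable k l
  have hind := (h.indepFun_row_minor i).comp measurable_id hm
  have := measureReal_le_of_indepFun (measurable_pi_lambda _ fun k => h.measurable i k)
    (hm.comp hV) hind hB hc
  simp only [Function.comp_apply, minorMatrix_shifted_congr] at this
  exact this

/-- The probability bound for the failure of one large deviation estimate. -/
noncomputable def tailBound (μ : ℕ → ℝ) (p : ℕ) (θ : ℝ) : ℝ :=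
  2 * ((2 * momentConst (entryConst μ p) p ^ 2) ^ p / θ ^ (2 * p))

theorem one_le_momentConst {K : ℝ} (hK : 1 ≤ K) (p : ℕ) : 1 ≤ momentConst K p := by
  have : (1 : ℝ) ≤ 4 ^ p := one_le_pow₀ (by norm_num)
  unfold momentConst
  nlinarith

theorem le_tailBound (μ : ℕ → ℝ) (p : ℕ) {θ : ℝ} (hθ : 0 < θ) :
    2 * (momentConst (entryConst μ p) p ^ p / θ ^ (2 * p)) ≤ tailBound μ p θ := by
  have h1 := one_le_momentConst (one_le_entryConst μ p) p
  unfold tailBound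
  gcongr
  nlinarith

theorem IsBandEnsemble.measureReal_not_isGoodRow_le (h : IsBandEnsemble P S μ H) (W : ℕ)
    (g : ZMod N → ℝ) (z w : ℂ) (i : ZMod N) {p : ℕ} (hp : 1 ≤ p) {θ : ℝ} (hθ : 0 < θ) :
    P.real {ω | ¬IsGoodRow S θ i (fun k => H ω i k)
        (fun k l => (minorMatrix (shifted W (H ω) g z w) i)⁻¹ k l)}
      ≤ (N + 3) * tailBound μ p θ := by
  have hK := one_le_entryConst μ p
  have hS := fun k => h.variance_nonneg i k
  set R : Ω → ZMod N → ZMod N → ℂ :=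
    fun ω k l => (minorMatrix (shifted W (H ω) g z w) i)⁻¹ k l with hR
  let L : ZMod N → Set ((ZMod N → ℝ) × (ZMod N → ZMod N → ℂ)) := fun j => {x |
    θ ^ 2 * ∑ k ∈ Finset.univ.erase i, S i k * ‖x.2 k j‖ ^ 2
      < ‖∑ k ∈ Finset.univ.erase i, (x.1 k : ℂ) * x.2 k j‖ ^ 2}
  let Q : Set ((ZMod N → ℝ) × (ZMod N → ZMod N → ℂ)) := {x |
    θ ^ 2 * ∑ k ∈ Finset.univ.erase i, ∑ l ∈ (Finset.univ.erase i).erase k,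
        S i k * S i l * ‖x.2 k l‖ ^ 2
      < ‖∑ k ∈ Finset.univ.erase i, ∑ l ∈ (Finset.univ.erase i).erase k,
        (x.1 k : ℂ) * x.1 l * x.2 k l‖ ^ 2}
  let D : Set ((ZMod N → ℝ) × (ZMod N → ZMod N → ℂ)) := {x |
    θ ^ 2 * ∑ k ∈ Finset.univ.erase i, S i k ^ 2 * ‖x.2 k k‖ ^ 2
      < ‖∑ k ∈ Finset.univ.erase i, ((x.1 k ^ 2 - S i k : ℝ) : ℂ) * x.2 k k‖ ^ 2}
  have hL : ∀ j, P.real {ω | (fun k => H ω i k, R ω) ∈ L j} ≤ tailBound μ p θ := fun j => by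
    refine h.measureReal_minor_le W g z w i (measurableSet_lt (by fun_prop) (by fun_prop))
      fun b => ?_
    have h1 := (h.isCenteredFamily_row p i).linear_tail hp hK hθ (fun k => b k j)
      (Finset.univ.erase i)
    simp only [Real.sq_sqrt (hS _)] at h1
    exact h1.trans (le_tailBound μ p hθ)
  have hQ : P.real {ω | (fun k => H ω i k, R ω) ∈ Q} ≤ tailBound μ p θ := by
    refine h.measureReal_minor_le W g z w i (measurableSet_lt (by fun_prop) (by fun_prop))
      fun b => ?_
    have h1 := (h.isCenteredFamily_row p i).quadratic_tail hp hK hθ b (Finset.univ.erase i)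
    simp only [Real.sq_sqrt (hS _)] at h1
    exact h1
  have hD : P.real {ω | (fun k => H ω i k, R ω) ∈ D} ≤ tailBound μ p θ := by
    refine h.measureReal_minor_le W g z w i (measurableSet_lt (by fun_prop) (by fun_prop))
      fun b => ?_
    exact ((h.isCenteredFamily_sq p i).linear_tail hp hK hθ (fun k => b k k)
      (Finset.univ.erase i)).trans (le_tailBound μ p hθ)
  -- The single entry `H i i` is a linear form over `{i}` with coefficient `1`.
  have hE : P.real {ω | θ ^ 2 * S i i < H ω i i ^ 2} ≤ tailBound μ p θ := by
    have h1 := (h.isCenteredFamily_row p i).linear_tail hp hK hθ (fun _ => 1) {i}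
    simp only [Real.sq_sqrt (hS _), Finset.sum_singleton, norm_one, one_pow, mul_one,
      Complex.norm_real, Real.norm_eq_abs, sq_abs] at h1
    exact h1.trans (le_tailBound μ p hθ)
  have hsub : {ω | ¬IsGoodRow S θ i (fun k => H ω i k) (R ω)}
      ⊆ (⋃ j, {ω | (fun k => H ω i k, R ω) ∈ L j}) ∪ {ω | (fun k => H ω i k, R ω) ∈ Q}
        ∪ {ω | (fun k => H ω i k, R ω) ∈ D} ∪ {ω | θ ^ 2 * S i i < H ω i i ^ 2} := by
    intro ω hω
    by_contra hcon
    simp only [Set.mem_union, Set.mem_iUnion, not_or, not_exists] at hcon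
    obtain ⟨⟨⟨h1, h2⟩, h3⟩, h4⟩ := hcon
    exact hω ⟨fun j => not_lt.1 (h1 j), not_lt.1 h2, not_lt.1 h3, not_lt.1 h4⟩
  refine (measureReal_mono hsub).trans ((measureReal_union_le _ _).trans ?_)
  have h1 := measureReal_union_le (μ := P)
    ((⋃ j, {ω | (fun k => H ω i k, R ω) ∈ L j}) ∪ {ω | (fun k => H ω i k, R ω) ∈ Q})
    {ω | (fun k => H ω i k, R ω) ∈ D}
  have h2 := measureReal_union_le (μ := P)
    (⋃ j, {ω | (fun k => H ω i k, R ω) ∈ L j}) {ω | (fun k => H ω i k, R ω) ∈ Q}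
  have h3 : P.real (⋃ j, {ω | (fun k => H ω i k, R ω) ∈ L j}) ≤ N * tailBound μ p θ := by
    refine (measureReal_iUnion_fintype_le _).trans ((Finset.sum_le_sum fun j _ => hL j).trans ?_)
    rw [Finset.sum_const, Finset.card_univ, ZMod.card, nsmul_eq_mul]
  linarith

theorem IsBandEnsemble.measureReal_exists_not_isGoodRow_le (h : IsBandEnsemble P S μ H) (W : ℕ)
    (g : ZMod N → ℝ) (z w : ℂ) {p : ℕ} (hp : 1 ≤ p) {θ : ℝ} (hθ : 0 < θ) :
    P.real {ω | ∃ i, ¬IsGoodRow S θ i (fun k => H ω i k)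
        (fun k l => (minorMatrix (shifted W (H ω) g z w) i)⁻¹ k l)}
      ≤ N * ((N + 3) * tailBound μ p θ) := by
  rw [Set.ofPred_exists]
  refine (measureReal_iUnion_fintype_le _).trans ((Finset.sum_le_sum fun i _ =>
    h.measureReal_not_isGoodRow_le W g z w i hp hθ).trans ?_)
  rw [Finset.sum_const, Finset.card_univ, ZMod.card, nsmul_eq_mul]

end GoodEvent

section MaxNorm

variable {n α : Type*} [Norm α]

theorem norm_le_maxNorm [Finite n] (X : Matrix n n α) (i j : n) : ‖X i j‖ ≤ maxNorm X :=
  (le_ciSup (Set.finite_range fun j => ‖X i j‖).bddAbove j).trans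
    (le_ciSup (Set.finite_range fun i => ⨆ j, ‖X i j‖).bddAbove i)

theorem maxNorm_le [Nonempty n] {X : Matrix n n α} {c : ℝ} (h : ∀ i j, ‖X i j‖ ≤ c) :
    maxNorm X ≤ c :=
  ciSup_le fun i => ciSup_le fun j => h i j

end MaxNorm

/-! ### From the good event to the bound on `G - M`. -/

section Deterministic

variable {N W : ℕ} {κ cs Cs c₀ : ℝ} {f : ZMod N → ℝ} {ζ : ℝ} {g : ZMod N → ℝ}
  {z w : ℂ}

theorem varMatrix_le_bandMatrix (hζ : 0 ≤ ζ) (i j : ZMod N) :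
    varMatrix N W f ζ i j ≤ bandMatrix f i j := by
  have h : 0 ≤ blockSigma N W i j := by
    simp only [blockSigma, Matrix.of_apply]
    split_ifs <;> positivity
  have h2 := mul_nonneg hζ h
  change bandMatrix f i j - ζ * blockSigma N W i j ≤ _
  linarith

theorem shifted_apply_of_ne (H : Matrix (ZMod N) (ZMod N) ℝ) {i k : ZMod N} (hik : i ≠ k) :
    shifted W H g z w i k = (H i k : ℂ) := by
  simp [shifted, hik]

theorem shifted_apply_self (H : Matrix (ZMod N) (ZMod N) ℝ) (i : ZMod N) :
    shifted W H g z w i i = (H i i : ℂ) - g i - spectralParam N W z w i := by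
  simp [shifted]

theorem shifted_symm {H : Matrix (ZMod N) (ZMod N) ℝ} (hH : ∀ i j, H i j = H j i)
    (i j : ZMod N) : shifted W H g z w i j = shifted W H g z w j i := by
  by_cases hij : i = j
  · rw [hij]
  · rw [shifted_apply_of_ne H hij, shifted_apply_of_ne H (Ne.symm hij), hH]

theorem shifted_eq_complexify (H : Matrix (ZMod N) (ZMod N) ℝ) :
    shifted W H g z w
      = complexify (H - Matrix.diagonal g) - Matrix.diagonal (spectralParam N W z w) := rfl

theorem one_div_seven_le_norm_msc (hre : |w.re| ≤ 2) (h0 : 0 ≤ w.im) (him : w.im ≤ 4) :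
    1 / 7 ≤ ‖msc w‖ := by
  have h1 := inv_msc w
  have h2 : ‖(msc w)⁻¹‖ ≤ 7 := by
    rw [h1]
    have h3 := norm_sub_le (-w) (msc w)
    rw [norm_neg] at h3
    have h4 := Complex.norm_le_abs_re_add_abs_im w
    rw [abs_of_nonneg h0] at h4
    linarith [norm_msc_le_one h0]
  rw [norm_inv] at h2
  have h3 : 0 < ‖msc w‖ := norm_pos_iff.2 (msc_ne_zero w)
  rw [inv_eq_one_div, div_le_iff₀ h3] at h2
  linarith

variable [NeZero N]

theorem IsAdmissible.sum_varMatrix_le (h : IsAdmissible κ cs Cs c₀ N W f ζ g z w) (i : ZMod N) :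
    ∑ j, varMatrix N W f ζ i j ≤ 1 :=
  (Finset.sum_le_sum fun j _ => varMatrix_le_bandMatrix h.zeta_nonneg i j).trans
    (h.profile.sum_row i).le

theorem IsAdmissible.varMatrix_le (h : IsAdmissible κ cs Cs c₀ N W f ζ g z w) (hCs : 0 < Cs)
    (i j : ZMod N) : varMatrix N W f ζ i j ≤ Cs * (W : ℝ)⁻¹ := by
  refine (varMatrix_le_bandMatrix h.zeta_nonneg i j).trans ?_
  rcases le_or_gt ((i - j).valMinAbs.natAbs : ℝ) (Cs * W) with h1 | h1
  · exact h.profile.upper _ h1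
  · change f (i - j) ≤ _
    rw [h.profile.support _ h1]
    positivity

/-- If `Im w ≤ 4`, then `|msc w| ≥ 1/7 > 1/8` excludes zero. If `Im w > 4`, all spectral parameters
have positive imaginary part since `‖z - w‖ ≤ 1`, and the quadratic form argument applies. -/
theorem IsAdmissible.resolvent_diag_ne_zero (hκ : 0 < κ) (hc : c₀ ≤ 1)
    (h : IsAdmissible κ cs Cs c₀ N W f ζ g z w) {H : Matrix (ZMod N) (ZMod N) ℝ}
    (hH : ∀ i j, H i j = H j i) (hA : IsUnit (shifted W H g z w)) {i : ZMod N}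
    (hG : ‖(shifted W H g z w)⁻¹ i i - msc w‖ ≤ 1 / 8) : (shifted W H g z w)⁻¹ i i ≠ 0 := by
  rcases le_or_gt w.im 4 with him | him
  · intro h0
    rw [h0, zero_sub, norm_neg] at hG
    have := one_div_seven_le_norm_msc (by linarith [h.re_w_le]) h.im_w_nonneg him
    linarith
  · rw [shifted_eq_complexify] at hA ⊢
    refine inv_apply_self_ne_zero (fun k l => ?_) (fun k => ?_) hA i
    · by_cases hkl : k = l
      · rw [hkl]
      · simp [hkl, Ne.symm hkl, hH k l]
    · have h1 := (Complex.abs_im_le_norm (z - w)).trans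
        (show ‖z - w‖ ≤ 1 by linarith [h.small, h.zeta_nonneg, norm_nonneg g])
      rw [Complex.sub_im, abs_le] at h1
      unfold spectralParam
      split_ifs <;> linarith [h1.1]

theorem norm_mul_le_of_sq_le {a b : ℂ} {θ V c : ℝ} (hb : ‖b‖ ^ 2 ≤ θ ^ 2 * V)
    (hV : ‖a‖ ^ 2 * V ≤ c ^ 2) (hθ : 0 ≤ θ) (hc : 0 ≤ c) : ‖a * b‖ ≤ c * θ := by
  rw [← pow_le_pow_iff_left₀ (norm_nonneg _) (by positivity) two_ne_zero, norm_mul]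
  calc (‖a‖ * ‖b‖) ^ 2 = ‖a‖ ^ 2 * ‖b‖ ^ 2 := mul_pow _ _ _
    _ ≤ ‖a‖ ^ 2 * (θ ^ 2 * V) := by gcongr
    _ = θ ^ 2 * (‖a‖ ^ 2 * V) := by ring
    _ ≤ θ ^ 2 * c ^ 2 := by gcongr
    _ = _ := by ring

/-- On the event where all large deviation bounds hold, the entries of the resolvent are close to
those of the deterministic approximation. -/
theorem IsAdmissible.maxNorm_sub_le_of_isGoodRow (hκ : 0 < κ) (hcs : 0 < cs) (hCs : 0 < Cs)
    (h : IsAdmissible κ cs Cs (pertRadius κ cs) N W f ζ g z w) {M : ZMod N → ℂ}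
    (hM : IsSelfConsistent W (varMatrix N W f ζ) g z w (solRadius κ cs) M)
    {H : Matrix (ZMod N) (ZMod N) ℝ} (hH : ∀ i j, H i j = H j i)
    (hS : ∀ i j, 0 ≤ varMatrix N W f ζ i j) (hA : IsUnit (shifted W H g z w))
    (hG : maxNorm (resolvent W H g z w - Matrix.diagonal M) ≤ solRadius κ cs) {Φ θ : ℝ}
    (hT : maxNorm (tMatrix (varMatrix N W f ζ) (resolvent W H g z w)) ≤ Φ ^ 2)
    (hΦ0 : 0 ≤ Φ) (hΦ1 : Φ ≤ 1) (hWΦ : (W : ℝ)⁻¹ ≤ Φ ^ 2) (hθ : 1 ≤ θ)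
    (hgood : ∀ i, IsGoodRow (varMatrix N W f ζ) θ i (fun k => H i k)
      (fun k l => (minorMatrix (shifted W H g z w) i)⁻¹ k l)) :
    maxNorm (resolvent W H g z w - Matrix.diagonal M)
      ≤ 30 * stabConst κ cs * (1 + Cs) * (θ * Φ) := by
  have hK := two_le_stabConst κ cs
  have hr := solRadius_le κ cs
  have hm := norm_msc_le_one h.im_w_nonneg
  have hsymm := shifted_symm (W := W) (g := g) (z := z) (w := w) hH
  set S := varMatrix N W f ζ with hSdef
  change maxNorm ((shifted W H g z w)⁻¹ - Matrix.diagonal M) ≤ solRadius κ cs at hG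
  change maxNorm (tMatrix S (shifted W H g z w)⁻¹) ≤ Φ ^ 2 at hT
  change maxNorm ((shifted W H g z w)⁻¹ - Matrix.diagonal M) ≤ _
  have hoffd : ∀ i k, i ≠ k → shifted W H g z w i k = (H i k : ℂ) := fun i k hik =>
    shifted_apply_of_ne H hik
  have hdiag : ∀ i, shifted W H g z w i i = (H i i : ℂ) - g i - spectralParam N W z w i :=
    shifted_apply_self H
  have hne0 : ∀ i, ‖(shifted W H g z w)⁻¹ i i - msc w‖ ≤ 1 / 8 →
      (shifted W H g z w)⁻¹ i i ≠ 0 := fun i =>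
    h.resolvent_diag_ne_zero hκ (by linarith [pertRadius_le κ cs]) hH hA
  set A := shifted W H g z w
  have hGd : ∀ i, ‖A⁻¹ i i - M i‖ ≤ solRadius κ cs := fun i => by
    have := (norm_le_maxNorm (A⁻¹ - Matrix.diagonal M) i i).trans hG
    rwa [Matrix.sub_apply, Matrix.diagonal_apply_eq] at this
  have hGo : ∀ i j, i ≠ j → ‖A⁻¹ i j‖ ≤ solRadius κ cs := fun i j hij => by
    have := (norm_le_maxNorm (A⁻¹ - Matrix.diagonal M) i j).trans hG
    rwa [Matrix.sub_apply, Matrix.diagonal_apply_ne _ hij, sub_zero] at this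
  have hGm : ∀ i, ‖A⁻¹ i i - msc w‖ ≤ 2 * solRadius κ cs := fun i => by
    have := norm_add_le (A⁻¹ i i - M i) (M i - msc w)
    rw [sub_add_sub_cancel] at this
    linarith [hGd i, hM.near i]
  have hne : ∀ i, A⁻¹ i i ≠ 0 := fun i => hne0 i ((hGm i).trans (by linarith))
  have hG2 : ∀ i j, ‖A⁻¹ i j‖ ≤ 2 := fun i j => by
    by_cases hij : i = j
    · subst hij
      have := norm_le_norm_sub_add (A⁻¹ i i) (msc w)
      linarith [hGm i]
    · exact (hGo i j hij).trans (by linarith)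
  have hTe : ∀ i j, ∑ k, S i k * ‖A⁻¹ k j‖ ^ 2 ≤ Φ ^ 2 := fun i j =>
    (le_abs_self _).trans ((norm_le_maxNorm (tMatrix S A⁻¹) i j).trans hT)
  have hrow : ∀ i, ∑ j, S i j ≤ 1 := h.sum_varMatrix_le
  have hSb : ∀ i j, S i j ≤ Cs * Φ ^ 2 := fun i j =>
    (h.varMatrix_le hCs i j).trans (by gcongr)
  -- Off the diagonal `G_ij` is `-G_ii` times a linear form in row `i`, so no self-consistent
  -- equation is needed.
  have hoff : ∀ i j, i ≠ j → ‖A⁻¹ i j‖ ≤ 4 * Φ * θ := by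
    intro i j hij
    have h1 := sum_mul_inv_minorMatrix hA (hne i) hij.symm
    have h2 : A⁻¹ i i * ∑ k ∈ Finset.univ.erase i, (H i k : ℂ) * (minorMatrix A i)⁻¹ k j
        = -A⁻¹ i j := by
      have h3 : ∑ k ∈ Finset.univ.erase i, (H i k : ℂ) * (minorMatrix A i)⁻¹ k j
          = ∑ k ∈ Finset.univ.erase i, A i k * (minorMatrix A i)⁻¹ k j :=
        Finset.sum_congr rfl fun k hk => by rw [hoffd i k (Finset.ne_of_mem_erase hk).symm]
      rw [h3, h1, mul_neg, mul_div_cancel₀ _ (hne i)]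
    have h3 := norm_mul_le_of_sq_le ((hgood i).linear j)
      (c := 4 * Φ) ((variance_linear_le hA (hne i) hG2 hS (hTe i) j).trans_eq (by ring))
      (by linarith) (by positivity)
    rwa [h2, norm_neg] at h3
  -- The residual collects `4` from the quadratic form, `8 (1 + Cs)` from the centered squares, `1`
  -- from `∑ S_ik G_ki²` and `2 (1 + Cs)` from `H i i`, all in units of `θ Φ`. Stability then
  -- multiplies by `2 K`.
  have hdg : ∀ i, ‖A⁻¹ i i * (-spectralParam N W z w i - (g i : ℂ)
        - ∑ j, (S i j : ℂ) * A⁻¹ j j) - 1‖ ≤ 15 * (1 + Cs) * (θ * Φ) := by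
    intro i
    have h1 := diagonal_equation (S := S) hA (hne i) hsymm
    have e1 : ∑ k ∈ Finset.univ.erase i, ∑ l ∈ (Finset.univ.erase i).erase k,
            A i k * A i l * (minorMatrix A i)⁻¹ k l
        = ∑ k ∈ Finset.univ.erase i, ∑ l ∈ (Finset.univ.erase i).erase k,
            (H i k : ℂ) * H i l * (minorMatrix A i)⁻¹ k l :=
      Finset.sum_congr rfl fun k hk => Finset.sum_congr rfl fun l hl => by
        rw [hoffd i k (Finset.ne_of_mem_erase hk).symm,
          hoffd i l (Finset.ne_of_mem_erase (Finset.mem_of_mem_erase hl)).symm]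
    have e2 : ∑ k ∈ Finset.univ.erase i,
            (A i k ^ 2 - (S i k : ℂ)) * (minorMatrix A i)⁻¹ k k
        = ∑ k ∈ Finset.univ.erase i,
            ((H i k ^ 2 - S i k : ℝ) : ℂ) * (minorMatrix A i)⁻¹ k k :=
      Finset.sum_congr rfl fun k hk => by
        rw [hoffd i k (Finset.ne_of_mem_erase hk).symm]
        push_cast
        rfl
    rw [e1, e2, hdiag] at h1
    have b1 := norm_mul_le_of_sq_le (a := A⁻¹ i i) (hgood i).quadratic (c := 4 * Φ)
      (le_trans (mul_le_mul_of_nonneg_left (Finset.sum_le_sum fun k _ =>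
        Finset.sum_le_sum_of_subset_of_nonneg (Finset.erase_subset _ _)
          fun l _ _ => mul_nonneg (mul_nonneg (hS i k) (hS i l)) (sq_nonneg _)) (sq_nonneg _))
        ((variance_quadratic_le hA (hne i) hG2 hS (hrow i) (hTe i)).trans_eq (by ring)))
      (by linarith) (by positivity)
    have hCsΦ : 64 * (Cs * Φ ^ 2) ≤ (8 * (1 + Cs) * Φ) ^ 2 := by
      nlinarith [mul_nonneg (sq_nonneg Φ) hCs.le, mul_nonneg (sq_nonneg Φ) (sq_nonneg Cs),
        sq_nonneg Φ]
    have b2 := norm_mul_le_of_sq_le (a := A⁻¹ i i) (hgood i).diagonal (c := 8 * (1 + Cs) * Φ)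
      ((variance_diagonal_le hA (hne i) hG2 hS (hrow i) (b := Cs * Φ ^ 2) (by positivity)
        (hSb i)).trans (by linarith))
      (by linarith) (by positivity)
    have b3 : ‖∑ k, (S i k : ℂ) * A⁻¹ k i ^ 2‖ ≤ Φ ^ 2 := by
      refine (norm_sum_le_of_le _ fun k _ => ?_).trans (hTe i i)
      rw [norm_mul, norm_pow, Complex.norm_real, Real.norm_of_nonneg (hS i k)]
    have b4 := norm_mul_le_of_sq_le (a := A⁻¹ i i) (b := (H i i : ℂ)) (c := 2 * (1 + Cs) * Φ)
      (V := S i i) (θ := θ)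
      (by rw [Complex.norm_real, Real.norm_eq_abs, sq_abs]; exact (hgood i).entry)
      (by
        have h4 : ‖A⁻¹ i i‖ ^ 2 ≤ 2 ^ 2 := pow_le_pow_left₀ (norm_nonneg _) (hG2 i i) 2
        calc _ ≤ 2 ^ 2 * (Cs * Φ ^ 2) := mul_le_mul h4 (hSb i i) (hS i i) (by norm_num)
          _ ≤ _ := by linarith)
      (by linarith) (by positivity)
    have e3 : A⁻¹ i i * (-spectralParam N W z w i - (g i : ℂ)
          - ∑ j, (S i j : ℂ) * A⁻¹ j j) - 1
        = (A⁻¹ i i * ∑ k ∈ Finset.univ.erase i, ∑ l ∈ (Finset.univ.erase i).erase k,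
            (H i k : ℂ) * H i l * (minorMatrix A i)⁻¹ k l)
          + (A⁻¹ i i * ∑ k ∈ Finset.univ.erase i,
            ((H i k ^ 2 - S i k : ℝ) : ℂ) * (minorMatrix A i)⁻¹ k k)
          - (∑ k, (S i k : ℂ) * A⁻¹ k i ^ 2) - A⁻¹ i i * (H i i : ℂ) := by
      linear_combination h1
    rw [e3]
    have hΦ2 : Φ ^ 2 ≤ θ * Φ := by nlinarith
    have hnn : 0 ≤ Cs * (θ * Φ) := by positivity
    refine (_root_.norm_sub_le _ _).trans ((add_le_add_left (_root_.norm_sub_le _ _) _).trans ?_)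
    have b5 := norm_add_le (A⁻¹ i i * ∑ k ∈ Finset.univ.erase i,
      ∑ l ∈ (Finset.univ.erase i).erase k, (H i k : ℂ) * H i l * (minorMatrix A i)⁻¹ k l)
      (A⁻¹ i i * ∑ k ∈ Finset.univ.erase i,
            ((H i k ^ 2 - S i k : ℝ) : ℂ) * (minorMatrix A i)⁻¹ k k)
    nlinarith
  have hθΦ : 0 ≤ θ * Φ := by positivity
  refine maxNorm_le fun i j => ?_
  by_cases hij : i = j
  · subst hij
    rw [Matrix.sub_apply, Matrix.diagonal_apply_eq]
    refine (h.norm_sub_le hκ hcs hM (y := fun k => A⁻¹ k k) hGm (by positivity) hdg i).trans_eq ?_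
    ring
  · rw [Matrix.sub_apply, Matrix.diagonal_apply_ne _ hij, sub_zero]
    refine (hoff i j hij).trans ?_
    calc 4 * Φ * θ = 4 * 1 * 1 * (θ * Φ) := by ring
      _ ≤ _ := by
        gcongr <;> linarith

end Deterministic

/-! ### Choice of the moment order and conclusion. -/

theorem natCast_mul_tailBound_le {μ : ℕ → ℝ} {p N : ℕ} {τ D : ℝ} (hN : 1 ≤ N)
    (hp : D + 3 ≤ τ * p) (hC : 8 * (2 * momentConst (entryConst μ p) p ^ 2) ^ p ≤ N) :
    N * ((N + 3) * tailBound μ p ((N : ℝ) ^ (τ / 2))) ≤ (N : ℝ) ^ (-D) := by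
  have hN1 : (1 : ℝ) ≤ N := by exact_mod_cast hN
  have hN0 : (0 : ℝ) < N := by linarith
  set c := (2 * momentConst (entryConst μ p) p ^ 2) ^ p with hc
  have hc0 : 0 ≤ c := by positivity
  have h1 : (((N : ℝ) ^ (τ / 2)) ^ (2 * p)) = (N : ℝ) ^ (τ * p) := by
    rw [← Real.rpow_natCast, ← Real.rpow_mul hN0.le]
    congr 1
    push_cast
    ring
  have h2 : (N : ℝ) ^ (D + 3) ≤ (N : ℝ) ^ (τ * p) := Real.rpow_le_rpow_of_exponent_le hN1 hp
  have h3 : (N : ℝ) ^ (D + 3) = (N : ℝ) ^ D * (N : ℝ) ^ 3 := by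
    rw [Real.rpow_add hN0]
    norm_cast
  have hD : 0 < (N : ℝ) ^ D := Real.rpow_pos_of_pos hN0 D
  unfold tailBound
  rw [h1, ← hc, Real.rpow_neg hN0.le]
  -- Of the three spare powers of `N`, two pay for the union bound and one absorbs the constant `8
  -- c`.
  calc (N : ℝ) * ((N + 3) * (2 * (c / (N : ℝ) ^ (τ * p))))
      ≤ N * ((N + 3 * N) * (2 * (c / ((N : ℝ) ^ D * (N : ℝ) ^ 3)))) := by
        rw [h3] at h2
        gcongr
        linarith
    _ = (8 * c) * (N : ℝ)⁻¹ * ((N : ℝ) ^ D)⁻¹ := by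
        field_simp
        ring
    _ ≤ N * (N : ℝ)⁻¹ * ((N : ℝ) ^ D)⁻¹ := by gcongr
    _ = _ := by rw [mul_inv_cancel₀ hN0.ne', one_mul]

theorem exists_threshold (a r c : ℝ) {δ τ : ℝ} (hδ : 0 < δ) (hτ : 0 < τ) (hr : 0 < r) :
    ∃ N₀ : ℕ, ∀ N : ℕ, N₀ ≤ N → 2 ≤ N ∧ (N : ℝ) ^ (-δ) ≤ r ∧ a < (N : ℝ) ^ (τ / 2) ∧ c ≤ N := by
  have h1 := ((tendsto_rpow_neg_atTop hδ).comp tendsto_natCast_atTop_atTop).eventually_le_const hr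
  have h2 := ((tendsto_rpow_atTop (half_pos hτ)).comp
    tendsto_natCast_atTop_atTop).eventually_gt_atTop a
  have h3 := (tendsto_natCast_atTop_atTop (R := ℝ)).eventually_ge_atTop c
  obtain ⟨N₀, hN₀⟩ := eventually_atTop.1 (((eventually_ge_atTop 2).and h1).and (h2.and h3))
  exact ⟨N₀, fun N hN => ⟨(hN₀ N hN).1.1, (hN₀ N hN).1.2, (hN₀ N hN).2.1, (hN₀ N hN).2.2⟩⟩

end BandMatrix

theorem lemma2p1 (κ cs Cs : ℝ) (hκ : 0 < κ) (hcs : 0 < cs) (hCs : 0 < Cs) :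
    ∃ c₀ c₁ : ℝ, 0 < c₀ ∧ 0 < c₁ ∧
      -- the vector `M` is well defined
      (∀ (N : ℕ) [NeZero N] (W : ℕ) (f : ZMod N → ℝ) (ζ : ℝ) (g : ZMod N → ℝ) (z w : ℂ),
        BandMatrix.IsAdmissible κ cs Cs c₀ N W f ζ g z w →
        ∃! M : ZMod N → ℂ,
          BandMatrix.IsSelfConsistent W (BandMatrix.varMatrix N W f ζ) g z w c₁ M) ∧
      -- the estimate
      (∀ (μ : ℕ → ℝ), (∀ p, 0 < μ p) → ∀ (δ τ D : ℝ), 0 < δ → 0 < τ → 0 < D →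
        ∃ N₀ : ℕ, ∀ (N : ℕ) [NeZero N], N₀ ≤ N →
        ∀ (W : ℕ) (f : ZMod N → ℝ) (ζ : ℝ) (g : ZMod N → ℝ) (z w : ℂ),
        BandMatrix.IsAdmissible κ cs Cs c₀ N W f ζ g z w →
        ∀ M : ZMod N → ℂ,
        BandMatrix.IsSelfConsistent W (BandMatrix.varMatrix N W f ζ) g z w c₁ M →
        ∀ (Ω : Type*) [MeasurableSpace Ω] (P : Measure Ω) [IsProbabilityMeasure P]
          (H : Ω → Matrix (ZMod N) (ZMod N) ℝ),
        BandMatrix.IsBandEnsemble P (BandMatrix.varMatrix N W f ζ) μ H →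
        ∀ (Φ : ℝ) (E : Set Ω), (W : ℝ) ^ (-(1 / 2) : ℝ) ≤ Φ →
        (∀ ω ∈ E,
          IsUnit (BandMatrix.shifted W (H ω) g z w) ∧
          BandMatrix.maxNorm (BandMatrix.resolvent W (H ω) g z w - Matrix.diagonal M)
            ≤ (N : ℝ) ^ (-δ) ∧
          BandMatrix.maxNorm (BandMatrix.tMatrix (BandMatrix.varMatrix N W f ζ)
            (BandMatrix.resolvent W (H ω) g z w)) ≤ Φ ^ 2) →
        P.real {ω | (N : ℝ) ^ τ * Φ ≤ E.indicator (fun ω' =>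
            BandMatrix.maxNorm (BandMatrix.resolvent W (H ω') g z w - Matrix.diagonal M)) ω}
          ≤ (N : ℝ) ^ (-D)) := by
  refine ⟨BandMatrix.pertRadius κ cs, BandMatrix.solRadius κ cs, BandMatrix.pertRadius_pos κ cs,
    BandMatrix.solRadius_pos κ cs, fun N _ W f ζ g z w h => h.existsUnique hκ hcs, ?_⟩
  intro μ _ δ τ D hδ hτ hD
  obtain ⟨p, hp⟩ := exists_nat_ge ((D + 3) / τ)
  have hp' : D + 3 ≤ τ * p := by
    rw [div_le_iff₀ hτ] at hp
    linarith
  have hp1 : 1 ≤ p := by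
    rcases Nat.eq_zero_or_pos p with rfl | h
    · simp only [Nat.cast_zero, mul_zero] at hp'
      linarith
    · exact h
  obtain ⟨N₀, hN₀⟩ := BandMatrix.exists_threshold (30 * BandMatrix.stabConst κ cs * (1 + Cs))
    (BandMatrix.solRadius κ cs)
    (8 * (2 * BandMatrix.momentConst (BandMatrix.entryConst μ p) p ^ 2) ^ p) hδ hτ
    (BandMatrix.solRadius_pos κ cs)
  refine ⟨N₀, ?_⟩
  intro N _ hN W f ζ g z w h M hM Ω _ P _ H hH Φ E hΦ hE
  obtain ⟨hN2, hNδ, hNτ, hNc⟩ := hN₀ N hN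
  have hN1 : (1 : ℝ) ≤ N := by exact_mod_cast (by omega : 1 ≤ N)
  -- Half of `N ^ τ` in the exponent goes to the large deviation bounds; the other half beats the
  -- constant `30 K (1 + Cs)`.
  set θ := (N : ℝ) ^ (τ / 2) with hθdef
  have hθ : 1 ≤ θ := Real.one_le_rpow hN1 (by linarith)
  have hθτ : (N : ℝ) ^ τ = θ * θ := by
    rw [hθdef, ← Real.rpow_add (by linarith)]
    congr 1
    ring
  have hW : (1 : ℝ) ≤ W := by exact_mod_cast h.one_le
  have hWpos : 0 < (W : ℝ) ^ (-(1 / 2) : ℝ) := Real.rpow_pos_of_pos (by linarith) _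
  have hΦ0 : 0 < Φ := hWpos.trans_le hΦ
  have hWΦ : (W : ℝ)⁻¹ ≤ Φ ^ 2 := by
    have h1 := pow_le_pow_left₀ hWpos.le hΦ 2
    rw [← Real.rpow_natCast, ← Real.rpow_mul (by linarith)] at h1
    norm_num at h1
    rwa [Real.rpow_neg_one] at h1
  have hNδ1 : (N : ℝ) ^ (-δ) < 1 := Real.rpow_lt_one_of_one_lt_of_neg
    (by exact_mod_cast (by omega : 1 < N)) (by linarith)
  -- Pointwise inclusion in the bad event suffices, so `E` need not be measurable.
  refine (measureReal_mono ?_).trans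
    ((hH.measureReal_exists_not_isGoodRow_le W g z w hp1 (θ := θ) (by linarith)).trans
      (BandMatrix.natCast_mul_tailBound_le (by omega) hp' hNc))
  intro ω hω
  have hpos : 0 < (N : ℝ) ^ τ * Φ := by positivity
  simp only [Set.mem_ofPred_eq] at hω ⊢
  by_cases hωE : ω ∈ E
  swap
  · rw [Set.indicator_of_notMem hωE] at hω
    linarith
  rw [Set.indicator_of_mem hωE] at hω
  obtain ⟨hA, hG, hT⟩ := hE ω hωE
  by_contra! hgood
  -- If `Φ > 1`, then `N ^ τ * Φ > 1 > N ^ (-δ)`, and the a priori bound on `E` already rules out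
  -- `ω`.
  have hΦ1 : Φ ≤ 1 := by
    by_contra! hΦ1
    have : 1 < (N : ℝ) ^ τ * Φ := by
      rw [hθτ]
      nlinarith
    linarith
  have key := h.maxNorm_sub_le_of_isGoodRow hκ hcs hCs hM (hH.symm ω)
    (fun i j => hH.variance_nonneg i j) hA (hG.trans hNδ) hT hΦ0.le hΦ1 hWΦ hθ hgood
  have hlt : 30 * BandMatrix.stabConst κ cs * (1 + Cs) * (θ * Φ) < θ * (θ * Φ) := by
    gcongr
  rw [hθτ] at hω
  linarith
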